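/- Let $\Gamma$ be a (finite simple) Euler graph, i.e. a graph all of whose vertex degrees are even, of odd order $n$. Let $A$ be its adjacency matrix, let $J$ be the all-ones matrix of order $n$, and write the characteristic polynomial of $J-2A$ as $\chi_{J-2A}(x)=\det(xI-(J-2A))=\sum_{i=0}^n a_i x^{n-i}$. Let $k\in\{2,\dots,(n-1)/2\}$, and let $\varphi$ denote Euler's totient function. Then $$a_{2k+1}\equiv \sum_{d\mid 2k}\ \sum_{\substack{m_1+2m_2+\cdots+d m_d=d\\ m_1,\dots,m_d\ge 0\\ m_{2k}=0}} C_d(m_1,\dots,m_d)\,P_d(m_1,\dots,m_d) \pmod{2^{2k+1}},$$ where $d$ runs over the positive divisors of $2k$, the condition $m_{2k}=0$ restricts only the case $d=2k$, $$C_d(m_1,\dots,m_d)=2^{2k}\,\frac{d\,\varphi(2k/d)}{2k}\,\frac{(m_1+\cdots+m_d-1)!}{m_1!\cdots m_d!},$$ $$P_d(m_1,\dots,m_d)=\prod_{1\le j\le d/2}\Bigl(\frac{a_{2j+1}}{2^{2j}n}\Bigr)^{m_{2j}}\ \prod_{1\le j\le (d+1)/2}\Bigl(\frac{a_{2j+1}+a_{2j}+a_{2j-1}a_3}{2^{2j-1}}\Bigr)^{m_{2j-1}},$$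 and, for rational numbers $x,y$, $x\equiv y\pmod{2^e}$ means that $x-y$ is $2^e$ times a fraction with odd denominator. Consequently the class of $a_{2k+1}$ modulo $2^{2k+1}$ is determined by $a_3,\dots,a_{2k}$: if $\Gamma'$ is another Euler graph of the same order $n$, with adjacency matrix $A'$ and $\chi_{J-2A'}(x)=\sum_{i=0}^n c_i x^{n-i}$, and if $a_i\equiv c_i\pmod{2^{2k+1}}$ for all $3\le i\le 2k$, then $a_{2k+1}\equiv c_{2k+1}\pmod{2^{2k+1}}$. -/

import Mathlib

/-- An Euler graph: every vertex has even degree (connectedness is not required). -/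
def IsEulerGraph {V : Type*} [Fintype V] (G : SimpleGraph V) [DecidableRel G.Adj] : Prop :=
  ∀ v : V, Even (G.degree v)

/-- The integer matrix `J - 2A`, with `J` the all-ones matrix and `A` the adjacency matrix of `G`. -/
def allOnesSubTwoAdj {V : Type*} [DecidableEq V] (G : SimpleGraph V)
    [DecidableRel G.Adj] : Matrix V V ℤ :=
  Matrix.of (fun _ _ => (1 : ℤ)) - (2 : ℤ) • G.adjMatrix ℤ

/-- `χ_M(x) = ∑_{i=0}^{n} a_i x^{n-i}`, where `χ_M(x) = det(xI - M)`. -/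
def HasCharCoeffs {V : Type*} [Fintype V] [DecidableEq V] (M : Matrix V V ℤ) (n : ℕ)
    (a : ℕ → ℤ) : Prop :=
  M.charpoly = ∑ i ∈ Finset.range (n + 1), Polynomial.C (a i) * Polynomial.X ^ (n - i)

/-- Congruence modulo `2 ^ e` for rational numbers: the 2-adic valuation of `x - y` is at
least `e`, i.e. `x - y` is `2 ^ e` times a fraction with odd denominator. -/
def RatModTwoPow (e : ℕ) (x y : ℚ) : Prop :=
  ∃ (z : ℤ) (u : ℕ), Odd u ∧ x - y = 2 ^ e * ((z : ℚ) / (u : ℚ))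

/-- On integers this is the usual congruence modulo `2 ^ e`. -/
theorem ratModTwoPow_intCast_iff (e : ℕ) (x y : ℤ) :
    RatModTwoPow e (x : ℚ) (y : ℚ) ↔ x ≡ y [ZMOD 2 ^ e] := by
  constructor
  · rintro ⟨z, u, hu, h⟩
    have hu0 : (u : ℚ) ≠ 0 := by
      have := hu.pos
      positivity
    have h1 : ((x - y) * (u : ℤ) : ℤ) = 2 ^ e * z := by
      have : ((x : ℚ) - y) * u = 2 ^ e * z := by rw [h]; field_simp
      exact_mod_cast this
    have hc : IsCoprime ((2 : ℤ) ^ e) (u : ℤ) := by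
      apply IsCoprime.pow_left
      rw [Int.isCoprime_iff_gcd_eq_one]
      exact (Nat.coprime_two_left.mpr hu)
    have h2 : (2 : ℤ) ^ e ∣ (x - y) := hc.dvd_of_dvd_mul_right ⟨z, h1⟩
    exact (Int.modEq_iff_dvd.mpr h2).symm
  · intro h
    obtain ⟨z, hz⟩ := Int.modEq_iff_dvd.mp h.symm
    refine ⟨z, 1, odd_one, ?_⟩
    have : ((x : ℚ) - y) = 2 ^ e * z := by exact_mod_cast hz
    simpa using this

open Classical in
/-- The tuples `(m_1, …, m_d)` of nonnegative integers with `m_1 + 2 m_2 + ⋯ + d m_d = d`, each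
extended by zero to a function on `ℕ` (see `mem_weightedTuples`). -/
noncomputable def weightedTuples (d : ℕ) : Finset (ℕ → ℕ) :=
  {m ∈ (Finset.range (d + 1)).biUnion (fun s => (Finset.Icc 1 d).piAntidiag s) |
    ∑ j ∈ Finset.Icc 1 d, j * m j = d}

theorem mem_weightedTuples (d : ℕ) (m : ℕ → ℕ) :
    m ∈ weightedTuples d ↔
      (∀ j, j ∉ Finset.Icc 1 d → m j = 0) ∧ ∑ j ∈ Finset.Icc 1 d, j * m j = d := by
  simp only [weightedTuples, Finset.mem_filter, Finset.mem_biUnion, Finset.mem_range,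
    Finset.mem_piAntidiag]
  constructor
  · rintro ⟨⟨s, -, -, h⟩, hd⟩
    refine ⟨fun j hj => ?_, hd⟩
    by_contra h0
    exact hj (h j h0)
  · rintro ⟨h, hd⟩
    refine ⟨⟨_, ?_, rfl, fun j hj => ?_⟩, hd⟩
    · rw [Nat.lt_succ_iff]
      calc ∑ j ∈ Finset.Icc 1 d, m j ≤ ∑ j ∈ Finset.Icc 1 d, j * m j :=
            Finset.sum_le_sum fun j hj =>
              Nat.le_mul_of_pos_left _ (Finset.mem_Icc.mp hj).1
        _ = d := hd
    · by_contra h0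
      exact hj (h j h0)

/-- `C_d(m_1,…,m_d) = 2^{2k} · (d φ(2k/d) / (2k)) · (m_1+⋯+m_d-1)! / (m_1! ⋯ m_d!)`,
for a divisor `d` of `2k`. -/
def coeffC (k d : ℕ) (m : ℕ → ℕ) : ℚ :=
  2 ^ (2 * k) * (((d : ℚ) * (Nat.totient (2 * k / d) : ℚ)) / (2 * (k : ℚ))) *
    ((Nat.factorial ((∑ j ∈ Finset.Icc 1 d, m j) - 1) : ℚ) /
      ∏ j ∈ Finset.Icc 1 d, (Nat.factorial (m j) : ℚ))

/-- `P_d(m_1,…,m_d) = ∏_j (a_{2j+1} / (2^{2j} n))^{m_{2j}} ·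
∏_j ((a_{2j+1} + a_{2j} + a_{2j-1} a_3) / 2^{2j-1})^{m_{2j-1}}`, the products running over all the
even indices `2j ≤ d` and all the odd indices `2j-1 ≤ d`. (The last factor of the second product
is `1` for even `d`, since `m_{d+1} = 0`.) -/
def prodP (n : ℕ) (a : ℕ → ℤ) (d : ℕ) (m : ℕ → ℕ) : ℚ :=
  (∏ j ∈ Finset.Icc 1 (d / 2), ((a (2 * j + 1) : ℚ) / (2 ^ (2 * j) * (n : ℚ))) ^ m (2 * j)) *
    ∏ j ∈ Finset.Icc 1 (d / 2 + 1),
      (((a (2 * j + 1) : ℚ) + (a (2 * j) : ℚ) + (a (2 * j - 1) : ℚ) * (a 3 : ℚ)) /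
        2 ^ (2 * j - 1)) ^ m (2 * j - 1)

/-! Write `det(I - tA) = ∑ b_j t^j`, let `W_s` be the number of walks with `s` edges, and let `N(x)`
be `necklaceSum k x`. At `x_j = -b_j`, Waring's formula gives `N(x) = (1/2k) ∑_{d ∣ 2k} φ(2k/d) tr
A^d`.

Parity. Burnside's lemma for the dihedral group of order `4k` acting on closed walks of length `2k`
gives `∑ φ(2k/d) tr A^d + k W_k = 4kz`: rotations fix shorter closed walks, half of the reflections
fix walks of length `k`, and the others fix nothing. For `k ≥ 2`, `W_k` is the quadratic form of
`A^(k-2)` at the degree vector, so it is divisible by 4 in an Euler graph. Hence `N(-b)` is an even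
integer (`exists_necklaceSum_adjCoeff`).

Stability. Changing the arguments by multiples of 4, over the rationals with odd denominator,
changes `N` by a multiple of 2 (`necklaceSum_sub_mem`). So each `-b_j` may be replaced by any
approximation modulo 4.

Approximation. The matrix determinant lemma gives `det(I - t(J - 2A)) = det(I + 2tA) (1 - t ∑ W_s
(-2t)^s)`. Since `4 ∣ W_s` for `s ≥ 2`, `W_1 = -2 b_2`, and `b_j` is even for odd `j`, the quotients
in `prodP` are congruent to `-b_j` modulo 4 (`exists_coeff_odd`, `exists_coeff_combination`).

Conclusion. `N(x) = x_(2k) + rest`, and the right-hand side of the theorem is `2^(2k)` times the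
rest. As `a_(2k+1) = 2^(2k) n x_(2k)` with `n` odd, evenness of `N` is the congruence. For the
second claim the exact values `-b_j` are used: since `b_1 = 0`, the variable `x_(2k-1)` drops out of
`N`, and the remaining `b_j` are known modulo 4 from `a_3, …, a_(2k)`. -/

/-- Entries of a matrix power as sums over sequences of vertices. -/
theorem matrix_pow_apply_eq_sum_prod {V R : Type*} [Fintype V] [DecidableEq V] [CommSemiring R]
    (M : Matrix V V R) (n : ℕ) (u v : V) :
    (M ^ n) u v = ∑ f : Fin (n + 1) → V, if f 0 = u ∧ f (Fin.last n) = v then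
      ∏ i : Fin n, M (f i.castSucc) (f i.succ) else 0 := by
  induction n generalizing u with
  | zero =>
    rw [← (Equiv.funUnique (Fin 1) V).symm.sum_comp]
    simp only [pow_zero, Matrix.one_apply, Finset.univ_eq_empty, Finset.prod_empty,
      Equiv.funUnique_symm_apply, uniqueElim_const]
    by_cases h : u = v
    · subst h
      simp
    · rw [if_neg h, Finset.sum_eq_zero]
      intro w _
      rw [if_neg]
      rintro ⟨rfl, h'⟩
      exact h h'
  | succ n ih =>
    have hcons : ∀ F : (Fin (n + 2) → V) → R,
        ∑ f, F f = ∑ g : Fin (n + 1) → V, ∑ w, F (Fin.cons w g) := by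
      intro F
      rw [← (Fin.consEquiv (fun _ : Fin (n + 2) => V)).sum_comp, Fintype.sum_prod_type_right]
      rfl
    rw [hcons, pow_succ', Matrix.mul_apply]
    simp only [ih, Finset.mul_sum]
    rw [Finset.sum_comm]
    refine Finset.sum_congr rfl fun f _ => ?_
    rw [Finset.sum_eq_single (f 0) (by intro w _ hw; simp [hw.symm]) (by simp),
      Finset.sum_eq_single u (by intro w _ hw; simp [hw]) (by simp)]
    simp only [Fin.cons_zero, ← Fin.succ_last, Fin.cons_succ, Fin.prod_univ_succ,
      Fin.castSucc_zero, ← Fin.succ_castSucc, true_and, mul_ite, mul_zero]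

/-! ### Closed walks and Burnside's lemma for the dihedral group -/

section ClosedWalks

variable {V : Type*} (G : SimpleGraph V)

theorem prod_adjMatrix_eq_ite [DecidableRel G.Adj] {n : ℕ} (f : Fin (n + 1) → V) :
    ∏ i : Fin n, G.adjMatrix ℤ (f i.castSucc) (f i.succ) =
      if ∀ i : Fin n, G.Adj (f i.castSucc) (f i.succ) then 1 else 0 := by
  simp only [SimpleGraph.adjMatrix_apply]
  rw [Finset.prod_ite_zero]
  simp

theorem trace_adjMatrix_pow_eq_card [Fintype V] [DecidableEq V] [DecidableRel G.Adj] (n : ℕ) :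
    (G.adjMatrix ℤ ^ n).trace = Fintype.card {f : Fin (n + 1) → V //
      f 0 = f (Fin.last n) ∧ ∀ i : Fin n, G.Adj (f i.castSucc) (f i.succ)} := by
  simp only [Matrix.trace, Matrix.diag, matrix_pow_apply_eq_sum_prod, prod_adjMatrix_eq_ite]
  rw [Finset.sum_comm, Fintype.card_subtype, Finset.card_filter, Nat.cast_sum]
  refine Finset.sum_congr rfl fun f _ => ?_
  rw [Finset.sum_eq_single (f 0) (by intro w _ hw; simp [hw.symm]) (by simp), ← ite_and]
  push_cast
  simp [eq_comm]

theorem sum_adjMatrix_pow_eq_card [Fintype V] [DecidableEq V] [DecidableRel G.Adj] (n : ℕ) :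
    ∑ u, ∑ v, (G.adjMatrix ℤ ^ n) u v = Fintype.card {f : Fin (n + 1) → V //
      ∀ i : Fin n, G.Adj (f i.castSucc) (f i.succ)} := by
  simp only [matrix_pow_apply_eq_sum_prod, prod_adjMatrix_eq_ite]
  simp_rw [Finset.sum_comm (t := (Finset.univ : Finset (Fin (n + 1) → V)))]
  rw [Fintype.card_subtype, Finset.card_filter, Nat.cast_sum]
  refine Finset.sum_congr rfl fun f _ => ?_
  rw [Finset.sum_eq_single (f 0) (by intro w _ hw; simp [hw.symm]) (by simp),
    Finset.sum_eq_single (f (Fin.last n)) (by intro w _ hw; simp [hw.symm]) (by simp)]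
  push_cast
  simp

/-- The closed walks of length `N`, as cyclic sequences of vertices. -/
abbrev CyclicWalk (N : ℕ) : Type _ := {f : ZMod N → V // ∀ x, G.Adj (f x) (f (x + 1))}

/-- The right action of the dihedral group on the indices of a cyclic sequence. -/
def dihedralIndex {N : ℕ} : DihedralGroup N → ZMod N → ZMod N
  | .r i, x => x + i
  | .sr i, x => i - x

instance dihedralCyclicWalkAction (N : ℕ) : MulAction (DihedralGroup N) (CyclicWalk G N) where
  smul g f := ⟨fun x => f.1 (dihedralIndex g x), by
    intro x
    cases g with
    | r i =>
      have := f.2 (x + i)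
      rwa [add_right_comm] at this
    | sr i =>
      have := (f.2 (i - (x + 1))).symm
      rwa [show i - (x + 1) + 1 = i - x by ring] at this⟩
  one_smul f := Subtype.ext <| funext fun x => congrArg f.1 (add_zero x)
  mul_smul g h f := Subtype.ext <| funext fun x => congrArg f.1 <| by
    cases g <;> cases h <;> simp only [DihedralGroup.r_mul_r, DihedralGroup.r_mul_sr,
      DihedralGroup.sr_mul_r, DihedralGroup.sr_mul_sr, dihedralIndex] <;> ring

theorem mem_fixedBy_r {N : ℕ} (i : ZMod N) (f : CyclicWalk G N) :
    f ∈ MulAction.fixedBy (CyclicWalk G N) (DihedralGroup.r i) ↔ ∀ x, f.1 (x + i) = f.1 x := by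
  rw [MulAction.mem_fixedBy, Subtype.ext_iff, funext_iff]
  rfl

theorem mem_fixedBy_sr {N : ℕ} (i : ZMod N) (f : CyclicWalk G N) :
    f ∈ MulAction.fixedBy (CyclicWalk G N) (DihedralGroup.sr i) ↔ ∀ x, f.1 (i - x) = f.1 x := by
  rw [MulAction.mem_fixedBy, Subtype.ext_iff, funext_iff]
  rfl

theorem zmod_val_add_natCast {N : ℕ} [NeZero N] (x : ZMod N) (i : ℕ) :
    (x + (i : ZMod N)).val = (x.val + i) % N := by
  conv_lhs => rw [← ZMod.natCast_zmod_val x, ← Nat.cast_add, ZMod.val_natCast]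

/-- By Bézout, `gcd(N, i)` is a multiple of `i` modulo `N`, so it is a period too. -/
theorem periodic_gcd {N : ℕ} (i : ℕ) (f : ZMod N → V) (h : ∀ x, f (x + (i : ZMod N)) = f x)
    (x : ZMod N) (q : ℕ) : f (x + ((N.gcd i * q : ℕ) : ZMod N)) = f x := by
  have hz : ∀ (z : ℤ) (x : ZMod N), f (x + (z : ZMod N) * (i : ZMod N)) = f x := by
    intro z x
    have hp : Function.Periodic f (i : ZMod N) := h
    exact hp.int_mul z x
  have hb := Nat.gcd_eq_gcd_ab N i
  have hb' : ((N.gcd i : ℕ) : ZMod N) = (Nat.gcdB N i : ZMod N) * (i : ZMod N) := by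
    have := congrArg (Int.cast : ℤ → ZMod N) hb
    push_cast at this
    rw [this]
    simp [mul_comm]
  have := hz (Nat.gcdB N i * q) x
  rw [← this]
  congr 2
  push_cast
  rw [hb']
  ring

/-- The closed walks invariant under a rotation are the closed walks of a smaller length. -/
def fixedByREquiv (N : ℕ) [NeZero N] (i : ℕ) :
    MulAction.fixedBy (CyclicWalk G N) (DihedralGroup.r (i : ZMod N)) ≃
      {f : Fin (N.gcd i + 1) → V //
        f 0 = f (Fin.last (N.gcd i)) ∧ ∀ j : Fin (N.gcd i), G.Adj (f j.castSucc) (f j.succ)} where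
  toFun f := ⟨fun j => f.1.1 ((j : ℕ) : ZMod N), by
    have hf := (mem_fixedBy_r G _ f.1).1 f.2
    refine ⟨?_, fun j => ?_⟩
    · have := periodic_gcd i f.1.1 hf 0 1
      simpa using this.symm
    · simpa using f.1.2 ((j : ℕ) : ZMod N)⟩
  invFun g := ⟨⟨fun x => g.1 ⟨x.val % N.gcd i, (Nat.mod_lt _
      (Nat.gcd_pos_of_pos_left _ (NeZero.pos N))).trans (Nat.lt_succ_self _)⟩, by
    intro x
    have hd : 0 < N.gcd i := Nat.gcd_pos_of_pos_left _ (NeZero.pos N)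
    have h1 : (x + 1).val % N.gcd i = (x.val + 1) % N.gcd i := by
      have := zmod_val_add_natCast x 1
      rw [Nat.cast_one] at this
      rw [this, Nat.mod_mod_of_dvd _ (Nat.gcd_dvd_left N i)]
    have hlt := Nat.mod_lt x.val hd
    have hadj := g.2.2 ⟨x.val % N.gcd i, hlt⟩
    have h2 : (x.val + 1) % N.gcd i = (x.val % N.gcd i + 1) % N.gcd i := by
      rw [Nat.mod_add_mod]
    -- At the end of a period the index wraps to 0, and the closing condition `g 0 = g (last)`
    -- identifies the two values.
    have hnext : g.1 ⟨(x + 1).val % N.gcd i, (Nat.mod_lt _ hd).trans (Nat.lt_succ_self _)⟩ =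
        g.1 (Fin.succ ⟨x.val % N.gcd i, hlt⟩) := by
      rcases Nat.lt_or_ge (x.val % N.gcd i + 1) (N.gcd i) with h | h
      · exact congrArg g.1 (Fin.ext (by simp only [h1, h2, Nat.mod_eq_of_lt h, Fin.succ_mk]))
      · have h3 : x.val % N.gcd i + 1 = N.gcd i := le_antisymm hlt h
        refine (congrArg g.1 (Fin.ext ?_)).trans
          (g.2.1.trans (congrArg g.1 (Fin.ext ?_)))
        · simp only [h1, h2, h3, Nat.mod_self, Fin.val_zero]
        · exact h3.symm
    rw [← hnext] at hadj
    exact hadj⟩, by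
    rw [mem_fixedBy_r]
    intro x
    refine congrArg g.1 (Fin.ext ?_)
    change (x + (i : ZMod N)).val % N.gcd i = x.val % N.gcd i
    rw [zmod_val_add_natCast, Nat.mod_mod_of_dvd _ (Nat.gcd_dvd_left N i)]
    obtain ⟨q, hq⟩ := Nat.gcd_dvd_right N i
    nth_rewrite 1 [hq]
    rw [Nat.add_mul_mod_self_left]⟩
  left_inv f := by
    have hf := (mem_fixedBy_r G _ f.1).1 f.2
    refine Subtype.ext <| Subtype.ext <| funext fun x => ?_
    have := periodic_gcd i f.1.1 hf ((x.val % N.gcd i : ℕ) : ZMod N) (x.val / N.gcd i)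
    rw [← Nat.cast_add, Nat.mod_add_div, ZMod.natCast_zmod_val] at this
    exact this.symm
  right_inv g := by
    refine Subtype.ext <| funext fun j => ?_
    simp only [ZMod.val_natCast, Nat.mod_mod_of_dvd _ (Nat.gcd_dvd_left N i)]
    rcases Nat.lt_or_ge j (N.gcd i) with h | h
    · simp only [Nat.mod_eq_of_lt h]
    · have hj : j = Fin.last _ := Fin.ext (le_antisymm (Nat.lt_succ_iff.1 j.2) h)
      subst hj
      rw [← g.2.1]
      exact congrArg g.1 (Fin.ext (by simp))

theorem natCast_add_sub_fold {k : ℕ} [NeZero (2 * k)] (b : ℕ) (x : ZMod (2 * k)) :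
    (b : ZMod (2 * k)) + ((min (x - (b : ZMod (2 * k))).val (2 * k - (x - (b : ZMod (2 * k))).val) : ℕ) : ZMod (2 * k)) = x ∨
    (b : ZMod (2 * k)) + ((min (x - (b : ZMod (2 * k))).val (2 * k - (x - (b : ZMod (2 * k))).val) : ℕ) : ZMod (2 * k)) =
      ((2 * b : ℕ) : ZMod (2 * k)) - x := by
  have hlt := ZMod.val_lt (x - (b : ZMod (2 * k)))
  rcases min_choice (x - (b : ZMod (2 * k))).val (2 * k - (x - (b : ZMod (2 * k))).val) with h | h
  · left
    rw [h, ZMod.natCast_zmod_val]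
    ring
  · right
    rw [h, Nat.cast_sub hlt.le, ZMod.natCast_zmod_val, ZMod.natCast_self]
    push_cast
    ring

/-- The closed walks invariant under a reflection through two vertices are the walks of half
the length. -/
def fixedBySREquiv (k : ℕ) [NeZero (2 * k)] (b : ℕ) :
    MulAction.fixedBy (CyclicWalk G (2 * k)) (DihedralGroup.sr ((2 * b : ℕ) : ZMod (2 * k))) ≃
      {f : Fin (k + 1) → V // ∀ j : Fin k, G.Adj (f j.castSucc) (f j.succ)} where
  toFun f := ⟨fun j => f.1.1 (b + (j : ℕ)), fun j => by
    simpa [add_assoc] using f.1.2 (b + (j : ℕ))⟩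
  -- The minimum is the cyclic distance from `x` to `b`: the walk is followed out to the antipode of
  -- `b` and then retraced.
  invFun g := ⟨⟨fun x => g.1 ⟨min (x - (b : ZMod (2 * k))).val (2 * k - (x - (b : ZMod (2 * k))).val), by omega⟩, by
    intro x
    have hlt := ZMod.val_lt (x - (b : ZMod (2 * k)))
    have h1 : (x + 1 - (b : ZMod (2 * k))).val = ((x - (b : ZMod (2 * k))).val + 1) % (2 * k) := by
      have := zmod_val_add_natCast (x - (b : ZMod (2 * k))) 1
      rwa [Nat.cast_one, sub_add_eq_add_sub] at this
    have h2 : (x + 1 - (b : ZMod (2 * k))).val = (x - (b : ZMod (2 * k))).val + 1 ∨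
        ((x - (b : ZMod (2 * k))).val + 1 = 2 * k ∧ (x + 1 - (b : ZMod (2 * k))).val = 0) := by
      rcases Nat.lt_or_ge ((x - (b : ZMod (2 * k))).val + 1) (2 * k) with h | h
      · left
        rw [h1, Nat.mod_eq_of_lt h]
      · right
        have h3 : (x - (b : ZMod (2 * k))).val + 1 = 2 * k := by omega
        exact ⟨h3, by rw [h1, h3, Nat.mod_self]⟩
    rcases Nat.lt_or_ge (x - (b : ZMod (2 * k))).val k with h | h
    · convert g.2 ⟨(x - (b : ZMod (2 * k))).val, h⟩ using 1
      · exact congrArg g.1 (Fin.ext (by simp; omega))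
      · exact congrArg g.1 (Fin.ext (by simp; omega))
    · convert (g.2 ⟨2 * k - (x - (b : ZMod (2 * k))).val - 1, by omega⟩).symm using 1
      · exact congrArg g.1 (Fin.ext (by simp; omega))
      · exact congrArg g.1 (Fin.ext (by simp; omega))⟩, by
    rw [mem_fixedBy_sr]
    intro x
    refine congrArg g.1 (Fin.ext ?_)
    have h1 : (((2 * b : ℕ) : ZMod (2 * k)) - x - (b : ZMod (2 * k))) = -(x - (b : ZMod (2 * k))) := by push_cast; ring
    have hlt := ZMod.val_lt (x - (b : ZMod (2 * k)))
    simp only [h1, ZMod.neg_val]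
    split_ifs with h
    · simp [h]
    · omega⟩
  left_inv f := by
    have hf := (mem_fixedBy_sr G _ f.1).1 f.2
    refine Subtype.ext <| Subtype.ext <| funext fun x => ?_
    change f.1.1 ((b : ZMod (2 * k)) +
      ((min (x - (b : ZMod (2 * k))).val (2 * k - (x - (b : ZMod (2 * k))).val) : ℕ) : ZMod (2 * k))) = f.1.1 x
    rcases natCast_add_sub_fold b x with h | h
    · rw [h]
    · rw [h, hf]
  right_inv g := by
    refine Subtype.ext <| funext fun j => ?_
    have hk : 0 < 2 * k := NeZero.pos _
    have hj := j.2
    refine congrArg g.1 (Fin.ext ?_)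
    simp only [add_sub_cancel_left]
    rw [ZMod.val_natCast, Nat.mod_eq_of_lt (by omega)]
    omega

/-- Such a reflection exchanges the neighbouring indices `b` and `b + 1`, so an invariant walk would
contain a loop. -/
theorem fixedBy_sr_odd {N : ℕ} (b : ℕ) (f : CyclicWalk G N) :
    f ∉ MulAction.fixedBy (CyclicWalk G N)
      (DihedralGroup.sr ((2 * b + 1 : ℕ) : ZMod N)) := by
  rw [mem_fixedBy_sr]
  intro h
  have h1 := h b
  have h2 := f.2 b
  rw [← h1] at h2
  refine h2.ne (congrArg f.1 ?_)
  push_cast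
  ring

theorem sum_zmod_eq_sum_range {M : Type*} [AddCommMonoid M] (N : ℕ) [NeZero N] (F : ZMod N → M) :
    ∑ i, F i = ∑ i ∈ Finset.range N, F (i : ZMod N) := by
  refine Finset.sum_nbij' ZMod.val (Nat.cast : ℕ → ZMod N) ?_ ?_ ?_ ?_ ?_
  · intro x _
    exact Finset.mem_range.2 (ZMod.val_lt x)
  · simp
  · simp
  · intro i hi
    exact ZMod.val_cast_of_lt (Finset.mem_range.1 hi)
  · simp

theorem sum_range_gcd_eq_sum_divisors (N : ℕ) (hN : N ≠ 0) (T : ℕ → ℤ) :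
    ∑ i ∈ Finset.range N, T (N.gcd i) = ∑ d ∈ N.divisors, ((N / d).totient : ℤ) * T d := by
  rw [← Finset.sum_fiberwise_of_maps_to (s := Finset.range N) (t := N.divisors)
    (g := fun i => N.gcd i) (fun i _ => Nat.mem_divisors.2 ⟨Nat.gcd_dvd_left N i, hN⟩)]
  refine Finset.sum_congr rfl fun d hd => ?_
  rw [Nat.totient_div_of_dvd (Nat.dvd_of_mem_divisors hd), ← nsmul_eq_mul, ← Finset.sum_const]
  exact Finset.sum_congr rfl fun i hi => by rw [(Finset.mem_filter.1 hi).2]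

theorem sum_range_two_mul_of_parity (k : ℕ) (F : ℕ → ℤ) (W : ℤ)
    (h0 : ∀ b, F (2 * b) = W) (h1 : ∀ b, F (2 * b + 1) = 0) :
    ∑ i ∈ Finset.range (2 * k), F i = k * W := by
  induction k with
  | zero => simp
  | succ k ih =>
    rw [show 2 * (k + 1) = 2 * k + 1 + 1 by ring, Finset.sum_range_succ, Finset.sum_range_succ,
      ih, h0, h1]
    push_cast
    ring

/-- The number of closed walks of length `2k` up to rotations and reflections is an integer. -/
theorem exists_sum_totient_mul_trace_add [Fintype V] [DecidableEq V] [DecidableRel G.Adj]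
    (k : ℕ) (hk : 0 < k) :
    ∃ z : ℤ, ∑ d ∈ (2 * k).divisors, ((2 * k / d).totient : ℤ) * (G.adjMatrix ℤ ^ d).trace +
      k * ∑ u, ∑ v, (G.adjMatrix ℤ ^ k) u v = 4 * k * z := by
  classical
  have : NeZero (2 * k) := ⟨by omega⟩
  have hB := MulAction.sum_card_fixedBy_eq_card_orbits_mul_card_group
    (DihedralGroup (2 * k)) (CyclicWalk G (2 * k))
  rw [DihedralGroup.card, ← DihedralGroup.equivSum.symm.sum_comp, Fintype.sum_sum_type,
    sum_zmod_eq_sum_range, sum_zmod_eq_sum_range] at hB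
  replace hB := congrArg (Nat.cast : ℕ → ℤ) hB
  push_cast at hB
  -- Only the `k` reflections of even index have fixed points.
  rw [add_comm, sum_range_two_mul_of_parity k _ (∑ u, ∑ v, (G.adjMatrix ℤ ^ k) u v)] at hB
  · rw [← sum_range_gcd_eq_sum_divisors _ (by omega), add_comm]
    refine ⟨Fintype.card (MulAction.orbitRel.Quotient (DihedralGroup (2 * k))
      (CyclicWalk G (2 * k))), Eq.trans ?_ (hB.trans ?_)⟩
    · refine congrArg₂ (· + ·) rfl (Finset.sum_congr rfl fun i _ => ?_)
      rw [trace_adjMatrix_pow_eq_card]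
      exact congrArg Nat.cast (Fintype.card_congr (fixedByREquiv G (2 * k) i)).symm
    · rw [mul_comm, ← mul_assoc]
      norm_num
  · intro b
    rw [sum_adjMatrix_pow_eq_card]
    exact congrArg Nat.cast (Fintype.card_congr (fixedBySREquiv G k b))
  · intro b
    rw [Nat.cast_eq_zero, Fintype.card_eq_zero_iff]
    exact ⟨fun f => fixedBy_sr_odd G b f.1 f.2⟩

end ClosedWalks

/-! ### Waring polynomials and their 2-adic stability -/

section Waring

/-- The polynomial in Waring's formula: the `d`-th power sum divided by `d`, in terms of the
negated coefficients of `∏ (1 - λ t)`. -/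
noncomputable def waringSum (d : ℕ) (x : ℕ → ℚ) : ℚ :=
  ∑ m ∈ weightedTuples d, ((Nat.factorial ((∑ j ∈ Finset.Icc 1 d, m j) - 1) : ℚ) /
    ∏ j ∈ Finset.Icc 1 d, (Nat.factorial (m j) : ℚ)) * ∏ j ∈ Finset.Icc 1 d, x j ^ m j

open Polynomial in
theorem coeff_sum_C_mul_X_pow_pow {R : Type*} [CommSemiring R] (d r : ℕ) (x : ℕ → R) :
    ((∑ j ∈ Finset.Icc 1 d, C (x j) * X ^ j) ^ r).coeff d =
      ∑ m ∈ (Finset.Icc 1 d).piAntidiag r with ∑ j ∈ Finset.Icc 1 d, j * m j = d,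
        (Nat.multinomial (Finset.Icc 1 d) m : R) * ∏ j ∈ Finset.Icc 1 d, x j ^ m j := by
  rw [Finset.sum_pow_eq_sum_piAntidiag, finsetSum_coeff, Finset.sum_filter]
  refine Finset.sum_congr rfl fun m _ => ?_
  simp only [mul_pow, Finset.prod_mul_distrib, ← pow_mul, ← C_pow, ← map_prod,
    Finset.prod_pow_eq_pow_sum]
  rw [← C_eq_natCast, ← mul_assoc, ← C_mul, coeff_C_mul, coeff_X_pow]
  simp only [eq_comm (a := d), mul_ite, mul_one, mul_zero]

-- Grouping the tuples by `r = m_1 + ⋯ + m_d` turns `(r-1)!/∏ m_j!` into a multinomial coefficient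
-- over `r`; this is the truncated series of `-log(1 - ∑ x_j t^j)`. The value `r = 0` is excluded
-- because the weight `d` is positive.
open Polynomial in
theorem waringSum_eq_sum_coeff {d : ℕ} (hd : 0 < d) (x : ℕ → ℚ) :
    waringSum d x = ∑ r ∈ Finset.Icc 1 d,
      (1 / (r : ℚ)) * ((∑ j ∈ Finset.Icc 1 d, C (x j) * X ^ j) ^ r).coeff d := by
  classical
  have h0 : ∀ m ∈ (Finset.Icc 1 d).piAntidiag 0, ¬ ∑ j ∈ Finset.Icc 1 d, j * m j = d := by
    intro m hm h
    rw [Finset.piAntidiag_zero, Finset.mem_singleton] at hm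
    subst hm
    simp at h
    omega
  rw [waringSum, weightedTuples, Finset.sum_filter, Finset.sum_biUnion, Finset.range_eq_Ico,
    Finset.sum_eq_sum_Ico_succ_bot (Nat.succ_pos d), Finset.sum_eq_zero, zero_add]
  · refine Finset.sum_congr (by ext; simp [Nat.one_le_iff_ne_zero]) fun r hr => ?_
    have hr1 : 1 ≤ r := (Finset.mem_Icc.1 hr).1
    have hr0 : (r : ℚ) ≠ 0 := by positivity
    rw [coeff_sum_C_mul_X_pow_pow, Finset.mul_sum, Finset.sum_filter]
    refine Finset.sum_congr ?_ fun m hm => ?_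
    · convert rfl
    have hs : ∑ j ∈ Finset.Icc 1 d, m j = r := (Finset.mem_piAntidiag.1 hm).1
    congr 1
    rw [← mul_assoc]
    congr 1
    have hf : (∏ j ∈ Finset.Icc 1 d, (Nat.factorial (m j) : ℚ)) ≠ 0 :=
      Finset.prod_ne_zero_iff.2 fun j _ => by positivity
    have hm' := congrArg (Nat.cast : ℕ → ℚ) (Nat.multinomial_spec (Finset.Icc 1 d) m)
    rw [hs] at hm' ⊢
    rw [← Nat.mul_factorial_pred (by omega : r ≠ 0)] at hm'
    push_cast at hm'
    rw [div_eq_iff hf]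
    field_simp
    linarith
  · intro m hm
    rw [if_neg]
    convert h0 m (by convert hm)
  · intro r _ s _ hrs
    refine Finset.disjoint_left.2 fun m hm hm' => hrs ?_
    rw [Finset.mem_piAntidiag] at hm hm'
    exact hm.1.symm.trans hm'.1

/-- The rational numbers with odd denominator. -/
def oddDenSubring : Subring ℚ where
  carrier := {q | Odd q.den}
  mul_mem' {a b} ha hb := Odd.of_dvd_nat (ha.mul hb) (Rat.mul_den_dvd a b)
  one_mem' := by simp
  add_mem' {a b} ha hb := Odd.of_dvd_nat (ha.mul hb) (Rat.add_den_dvd a b)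
  zero_mem' := by simp
  neg_mem' {a} ha := by simpa using ha

theorem inv_natCast_mem_oddDenSubring {u : ℕ} (hu : Odd u) : (u : ℚ)⁻¹ ∈ oddDenSubring := by
  have h0 : u ≠ 0 := by rintro rfl; simp at hu
  change Odd ((u : ℚ)⁻¹).den
  simpa [h0] using hu

theorem ratModTwoPow_iff (e : ℕ) (x y : ℚ) :
    RatModTwoPow e x y ↔ ∃ z ∈ oddDenSubring, x - y = 2 ^ e * z := by
  constructor
  · rintro ⟨z, u, hu, h⟩
    exact ⟨z / u, by
      rw [div_eq_mul_inv]
      exact mul_mem (intCast_mem _ z) (inv_natCast_mem_oddDenSubring hu), h⟩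
  · rintro ⟨z, hz, h⟩
    exact ⟨z.num, z.den, hz, by rw [Rat.num_div_den]; exact h⟩

/-- If `2^v` divides `i + 1`, then `v < 2^v ≤ i + 1`, so `4^i` absorbs the 2-part of the
denominator. -/
theorem four_pow_div_mem_oddDenSubring (i : ℕ) :
    (4 : ℚ) ^ i / ((i + 1 : ℕ) : ℚ) ∈ oddDenSubring := by
  obtain ⟨v, m, hm, h⟩ := Nat.exists_eq_two_pow_mul_odd (Nat.succ_ne_zero i)
  rw [Nat.succ_eq_add_one] at h
  have h0 : m ≠ 0 := by rintro rfl; simp at hm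
  have hm1 : 0 < m := Nat.pos_of_ne_zero h0
  have hv : v ≤ i := by
    have h1 : v < 2 ^ v := Nat.lt_two_pow_self
    have h2 : 2 ^ v ≤ i + 1 := by
      rw [h]
      exact Nat.le_mul_of_pos_right _ hm1
    omega
  obtain ⟨w, rfl⟩ := Nat.exists_eq_add_of_le hv
  have : (4 : ℚ) ^ (v + w) / ((v + w + 1 : ℕ) : ℚ) =
      ((2 ^ v * 4 ^ w : ℕ) : ℚ) * (m : ℚ)⁻¹ := by
    rw [h]
    push_cast
    rw [show (4 : ℚ) ^ (v + w) = 2 ^ v * 2 ^ v * 4 ^ w by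
      rw [pow_add, ← mul_pow]; norm_num]
    field_simp
  rw [this]
  exact mul_mem (natCast_mem _ _) (inv_natCast_mem_oddDenSubring hm)

theorem choose_div_eq (r i : ℕ) :
    (1 / ((r + 1 : ℕ) : ℚ)) * ((r + 1).choose (i + 1) : ℚ) =
      (r.choose i : ℚ) * (1 / ((i + 1 : ℕ) : ℚ)) := by
  have := congrArg (Nat.cast : ℕ → ℚ) (Nat.add_one_mul_choose_eq r i)
  push_cast at this ⊢
  field_simp
  linarith

open Polynomial in
/-- The Waring polynomials preserve congruence modulo `4` over the rationals with odd
denominator. -/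
theorem waringSum_add_four_mul {d : ℕ} (hd : 0 < d) (x u : ℕ → oddDenSubring) :
    ∃ z : oddDenSubring, waringSum d (fun j => x j + 4 * u j) -
      waringSum d (fun j => x j) = 4 * z := by
  set P : oddDenSubring[X] := ∑ j ∈ Finset.Icc 1 d, C (x j) * X ^ j with hP
  set U : oddDenSubring[X] := ∑ j ∈ Finset.Icc 1 d, C (u j) * X ^ j with hU
  set φ := oddDenSubring.subtype
  have hPm : (∑ j ∈ Finset.Icc 1 d, C (x j : ℚ) * X ^ j) = P.map φ := by
    simp [hP, φ, Polynomial.map_sum]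
  have hUm : (∑ j ∈ Finset.Icc 1 d, C (x j + 4 * u j : ℚ) * X ^ j) =
      C 4 * U.map φ + P.map φ := by
    rw [hP, hU]
    simp only [Polynomial.map_sum, Polynomial.map_mul, Polynomial.map_pow, map_C, map_X,
      Finset.mul_sum, ← Finset.sum_add_distrib]
    refine Finset.sum_congr rfl fun j _ => ?_
    simp only [φ, Subring.subtype_apply, C_add, C_mul]
    ring
  rw [waringSum_eq_sum_coeff hd, waringSum_eq_sum_coeff hd, ← Finset.sum_sub_distrib]
  suffices h : ∀ r ∈ Finset.Icc 1 d, ∃ z : oddDenSubring,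
      1 / (r : ℚ) * ((∑ j ∈ Finset.Icc 1 d, C (x j + 4 * u j : ℚ) * X ^ j) ^ r).coeff d -
      1 / (r : ℚ) * ((∑ j ∈ Finset.Icc 1 d, C (x j : ℚ) * X ^ j) ^ r).coeff d = 4 * z by
    choose! z hz using h
    refine ⟨∑ r ∈ Finset.Icc 1 d, z r, ?_⟩
    rw [Finset.sum_congr rfl hz, ← Finset.mul_sum]
    push_cast
    rfl
  intro r hr
  obtain ⟨r, rfl⟩ : ∃ s, r = s + 1 := ⟨r - 1, by have := (Finset.mem_Icc.1 hr).1; omega⟩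
  -- In the binomial expansion of `(4U + P)^(r+1) / (r+1)` the term without `U` cancels. In the
  -- others, `choose_div_eq` trades the denominator `r + 1` for `i + 1`, and one factor 4 is left
  -- over after `4^i` clears the 2-part of `i + 1`.
  rw [hPm, hUm, add_pow, finsetSum_coeff, Finset.sum_range_succ']
  refine ⟨∑ i ∈ Finset.range (r + 1), ⟨4 ^ i / ((i + 1 : ℕ) : ℚ),
    four_pow_div_mem_oddDenSubring i⟩ * (r.choose i : oddDenSubring) *
      (U ^ (i + 1) * P ^ (r - i)).coeff d, ?_⟩
  simp only [pow_zero, one_mul, Nat.sub_zero, Nat.choose_zero_right, Nat.cast_one, mul_one,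
    mul_add, add_sub_cancel_right, Finset.mul_sum]
  push_cast
  rw [Finset.mul_sum]
  refine Finset.sum_congr rfl fun i _ => ?_
  have hc := choose_div_eq r i
  rw [← C_eq_natCast, coeff_mul_C, mul_pow, ← C_pow, mul_assoc, coeff_C_mul,
    ← Polynomial.map_pow, ← Polynomial.map_pow, ← Polynomial.map_mul,
    coeff_map]
  simp only [φ, Subring.subtype_apply]
  push_cast at hc ⊢
  linear_combination (4 ^ (i + 1) * ((U ^ (i + 1) * P ^ (r - i)).coeff d : ℚ)) * hc

end Waring

/-! ### Power sums from the logarithmic derivative -/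

section PowerSums

open PowerSeries

/-- The generating function of the power sums, cleared of denominators. -/
theorem prod_mul_mk_powerSum {K ι : Type*} [Field K] (s : Finset ι) (l : ι → K) :
    (∏ i ∈ s, (1 - C (l i) * X)) * (PowerSeries.mk fun d => ∑ i ∈ s, l i ^ (d + 1)) =
      -d⁄dX K (∏ i ∈ s, (1 - C (l i) * X)) := by
  classical
  induction s using Finset.induction_on with
  | empty =>
    ext n
    simp
  | insert a s ha ih =>
    have h1 : (PowerSeries.mk fun d => ∑ i ∈ insert a s, l i ^ (d + 1)) =
        (PowerSeries.mk fun d => l a ^ (d + 1)) +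
          PowerSeries.mk fun d => ∑ i ∈ s, l i ^ (d + 1) := by
      ext n
      simp [Finset.sum_insert ha]
    have h2 : (1 - C (l a) * X) * (PowerSeries.mk fun d => l a ^ (d + 1)) = C (l a) := by
      ext n
      rw [sub_mul, one_mul, mul_assoc, map_sub, coeff_C_mul]
      cases n with
      | zero => simp
      | succ n =>
        rw [coeff_succ_X_mul, coeff_C]
        simp [pow_succ']
    have h3 : d⁄dX K (1 - C (l a) * X) = -C (l a) := by
      simp [Derivation.leibniz]
    rw [h1, Finset.prod_insert ha, Derivation.leibniz, h3]
    simp only [smul_eq_mul]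
    linear_combination (∏ i ∈ s, (1 - C (l i) * X)) * h2 + (1 - C (l a) * X) * ih

theorem powerSum_eq_sum_coeff {K ι : Type*} [Field K] [CharZero K] (s : Finset ι) (l : ι → K)
    {d : ℕ} (hd : 0 < d) :
    ∑ i ∈ s, l i ^ d = ∑ r ∈ Finset.Icc 1 d,
      (d / r : K) * coeff d ((1 - ∏ i ∈ s, (1 - C (l i) * X)) ^ r) := by
  set D : K⟦X⟧ := ∏ i ∈ s, (1 - C (l i) * X) with hD
  set P : K⟦X⟧ := PowerSeries.mk fun d => ∑ i ∈ s, l i ^ (d + 1) with hP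
  have h := prod_mul_mk_powerSum s l
  rw [← hD, ← hP] at h
  have hgeom := mul_neg_geom_sum (1 - D) d
  rw [sub_sub_cancel] at hgeom
  have hX : X ∣ (1 - D) := by
    rw [X_dvd_iff]
    simp [hD]
  obtain ⟨E, hE⟩ : X ^ d ∣ (1 - D) ^ d := pow_dvd_pow_of_dvd hX d
  have hd1 : d⁄dX K (1 - D) = -d⁄dX K D := by simp
  -- From `D P = -D'`, expand `1/D` as a geometric series in `1 - D`. Since `X` divides `1 - D`,
  -- cutting the series at `d` terms alters only coefficients of degree at least `d`. Each remaining
  -- term is the derivative of a power of `1 - D` up to a scalar.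
  have hkey : P - X ^ d * (E * P) = ∑ r ∈ Finset.range d, (1 - D) ^ r * d⁄dX K (1 - D) := by
    rw [← Finset.sum_mul, hd1, ← h]
    linear_combination (-P) * hgeom + P * hE
  obtain ⟨d, rfl⟩ : ∃ e, d = e + 1 := ⟨d - 1, by omega⟩
  have hco := congrArg (coeff d) hkey
  have hlow : coeff d (X ^ (d + 1) * (E * P)) = 0 := by
    rw [coeff_X_pow_mul', if_neg (by omega)]
  rw [map_sub, hlow, hP, coeff_mk, sub_zero] at hco
  rw [hco, map_sum, show Finset.Icc 1 (d + 1) = Finset.Ico (0 + 1) (d + 1 + 1) by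
    ext; simp, ← Finset.sum_Ico_add' _ 0 (d + 1) 1, Finset.range_eq_Ico]
  refine Finset.sum_congr rfl fun r _ => ?_
  have hr : ((r + 1 : ℕ) : K) ≠ 0 := Nat.cast_ne_zero.2 (Nat.succ_ne_zero r)
  have hder := congrArg (coeff d) (derivative_pow (R := K) (1 - D) (r + 1))
  rw [coeff_derivative, Nat.add_sub_cancel, mul_assoc, ← nsmul_eq_mul, map_nsmul,
    nsmul_eq_mul] at hder
  rw [div_mul_eq_mul_div, eq_div_iff hr]
  push_cast at hder ⊢
  linear_combination -hder

end PowerSums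

/-! ### Traces of powers in terms of characteristic coefficients -/

section Trace

variable {V : Type*} [Fintype V] [DecidableEq V]

theorem trace_pow_eq_sum_eigenvalues_pow {B : Matrix V V ℝ} (hB : B.IsHermitian) (d : ℕ) :
    (B ^ d).trace = ∑ i, hB.eigenvalues i ^ d := by
  conv_lhs => rw [hB.spectral_theorem]
  rw [← map_pow, Unitary.conjStarAlgAut_apply, Matrix.trace_mul_comm, ← mul_assoc,
    Unitary.coe_star_mul_self, one_mul, Matrix.diagonal_pow, Matrix.trace_diagonal]
  rfl

open Polynomial

theorem reverse_X_sub_C {R : Type*} [CommRing R] [Nontrivial R] (a : R) :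
    (X - C a).reverse = 1 - C a * X := by
  ext i
  rw [coeff_reverse, natDegree_X_sub_C]
  rcases i with _ | _ | i
  · rw [revAt_le (by omega)]
    simp [coeff_C]
  · rw [revAt_le (by omega)]
    simp [coeff_one]
  · rw [revAt_eq_self_of_lt (by omega)]
    simp [coeff_X, coeff_one]

theorem charpolyRev_eq_prod_eigenvalues {B : Matrix V V ℝ} (hB : B.IsHermitian) :
    B.charpolyRev = ∏ i, (1 - C (hB.eigenvalues i) * X) := by
  rw [← Matrix.reverse_charpoly, hB.charpoly_eq]
  have : ∀ s : Finset V, (∏ i ∈ s, (X - C (hB.eigenvalues i))).reverse =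
      ∏ i ∈ s, (1 - C (hB.eigenvalues i) * X) := by
    intro s
    induction s using Finset.induction_on with
    | empty => simpa using reverse_C (1 : ℝ)
    | insert a s ha ih =>
      rw [Finset.prod_insert ha, Finset.prod_insert ha, reverse_mul_of_domain, ih, reverse_X_sub_C]
  exact this Finset.univ

theorem map_charpolyRev {R S : Type*} [CommRing R] [CommRing S] (f : R →+* S)
    (M : Matrix V V R) : (M.map f).charpolyRev = M.charpolyRev.map f := by
  rw [Matrix.charpolyRev, Matrix.charpolyRev, ← coe_mapRingHom, RingHom.map_det]
  congr 1
  ext1 i j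
  simp [Matrix.one_apply, apply_ite]

theorem coeff_pow_congr {R : Type*} [CommRing R] {p q : R[X]} {d : ℕ}
    (h : ∀ j ≤ d, p.coeff j = q.coeff j) (r : ℕ) : (p ^ r).coeff d = (q ^ r).coeff d := by
  have h1 : X ^ (d + 1) ∣ p - q := by
    rw [X_pow_dvd_iff]
    intro j hj
    rw [coeff_sub, h j (Nat.lt_succ_iff.1 hj), sub_self]
  have h2 := (X_pow_dvd_iff.1 (h1.trans (sub_dvd_pow_sub_pow p q r))) d (Nat.lt_succ_self d)
  rwa [coeff_sub, sub_eq_zero] at h2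

/-- Over the reals the symmetric matrix is diagonalizable, so its traces are power sums of
eigenvalues and `charpolyRev` is `∏ (1 - λ X)`; the resulting identity is rational and descends. -/
theorem trace_pow_eq_sum_coeff {A : Matrix V V ℤ} (hA : A.IsSymm) {d : ℕ} (hd : 0 < d) :
    ((A ^ d).trace : ℚ) = ∑ r ∈ Finset.Icc 1 d,
      (d / r : ℚ) * (((1 - A.charpolyRev) ^ r).coeff d : ℤ) := by
  have hB : (A.map (Int.castRingHom ℝ)).IsHermitian := by
    ext i j
    simp [Matrix.conjTranspose_apply, hA.apply j i]
  have h1 := trace_pow_eq_sum_eigenvalues_pow hB d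
  rw [powerSum_eq_sum_coeff Finset.univ _ hd] at h1
  have h2 : (1 - ∏ i, (1 - PowerSeries.C (hB.eigenvalues i) * PowerSeries.X) : PowerSeries ℝ) =
      (((1 - A.charpolyRev).map (Int.castRingHom ℝ) : ℝ[X]) : PowerSeries ℝ) := by
    rw [Polynomial.map_sub, Polynomial.map_one, ← map_charpolyRev,
      charpolyRev_eq_prod_eigenvalues hB, ← coeToPowerSeries.ringHom_apply, map_sub, map_prod]
    simp
  rw [h2] at h1
  have h3 : (((A ^ d).trace : ℚ) : ℝ) = ((A.map (Int.castRingHom ℝ)) ^ d).trace := by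
    have := AddMonoidHom.map_trace (Int.castRingHom ℝ).toAddMonoidHom (A ^ d)
    have h4 := Matrix.map_pow A (Int.castRingHom ℝ) d
    rw [← h4]
    simpa using this
  have h5 : (((A ^ d).trace : ℚ) : ℝ) = ((∑ r ∈ Finset.Icc 1 d,
      (d / r : ℚ) * (((1 - A.charpolyRev) ^ r).coeff d : ℤ) : ℚ) : ℝ) := by
    rw [h3, h1]
    push_cast
    refine Finset.sum_congr rfl fun r _ => ?_
    rw [← coe_pow, coeff_coe, ← Polynomial.map_pow, coeff_map]
    rfl
  exact_mod_cast h5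

/-- **Waring's formula** for the traces of the powers of a symmetric integer matrix. -/
theorem trace_pow_eq_mul_waringSum {A : Matrix V V ℤ} (hA : A.IsSymm) {d : ℕ} (hd : 0 < d) :
    ((A ^ d).trace : ℚ) = d * waringSum d fun j => -(A.charpolyRev.coeff j : ℚ) := by
  rw [trace_pow_eq_sum_coeff hA hd, waringSum_eq_sum_coeff hd, Finset.mul_sum]
  refine Finset.sum_congr rfl fun r _ => ?_
  have h : (∑ j ∈ Finset.Icc 1 d, C (-(A.charpolyRev.coeff j : ℚ)) * X ^ j) =
      (∑ j ∈ Finset.Icc 1 d, C (-(A.charpolyRev.coeff j)) * X ^ j).map (Int.castRingHom ℚ) := by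
    simp [Polynomial.map_sum]
  rw [h, ← Polynomial.map_pow, coeff_map,
    coeff_pow_congr (p := ∑ j ∈ Finset.Icc 1 d, C (-(A.charpolyRev.coeff j)) * X ^ j)
      (q := 1 - A.charpolyRev)]
  · simp only [eq_intCast]
    ring
  · intro j hj
    simp only [finsetSum_coeff, coeff_C_mul_X_pow, coeff_sub, coeff_one]
    rcases Nat.eq_zero_or_pos j with rfl | hj0
    · have h0 : A.charpolyRev.coeff 0 = 1 := by
        rw [coeff_zero_eq_eval_zero, Matrix.eval_charpolyRev]
      simp [h0]
    · rw [Finset.sum_ite_eq, if_pos (Finset.mem_Icc.2 ⟨hj0, hj⟩), if_neg (by omega)]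
      ring

end Trace

/-! ### Reversed characteristic polynomials: rank-one update and parity -/

section CharpolyRev

variable {V : Type*} [Fintype V] [DecidableEq V] {R : Type*} [CommRing R]

theorem charpolyRev_coeff_zero (M : Matrix V V R) : M.charpolyRev.coeff 0 = 1 := by
  rw [Polynomial.coeff_zero_eq_eval_zero, Matrix.eval_charpolyRev]

open Polynomial in
theorem charpolyRev_smul_coeff (c : R) (M : Matrix V V R) (j : ℕ) :
    (c • M).charpolyRev.coeff j = c ^ j * M.charpolyRev.coeff j := by
  have h : (c • M).charpolyRev = M.charpolyRev.comp (C c * X) := by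
    rw [Matrix.charpolyRev, Matrix.charpolyRev, ← coe_compRingHom_apply, RingHom.map_det]
    congr 1
    ext1 i k
    by_cases hik : i = k
    · subst hik
      simp
      ring
    · simp [hik]
      ring
  rw [h, comp_C_mul_X_coeff, mul_comm]

theorem charpolyRev_transpose (M : Matrix V V R) :
    M.transpose.charpolyRev = M.charpolyRev := by
  rw [Matrix.charpolyRev, Matrix.charpolyRev, ← Matrix.det_transpose]
  congr 1
  ext1 i j
  simp [Matrix.one_apply, eq_comm]

open PowerSeries in
/-- The effect of adding the all-ones matrix on the reversed characteristic polynomial. -/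
theorem coe_charpolyRev_ones_add (M : Matrix V V R) :
    ((Matrix.of (fun _ _ => (1 : R)) + M).charpolyRev : R⟦X⟧) =
      (M.charpolyRev : R⟦X⟧) * (1 - X * PowerSeries.mk fun s => ∑ u, ∑ v, (M ^ s) u v) := by
  set S : Matrix V V R⟦X⟧ := 1 - (X : R⟦X⟧) • M.map (C (R := R)) with hS
  set N : Matrix V V R⟦X⟧ := Matrix.of fun u v => PowerSeries.mk fun s => (M ^ s) u v with hN
  have hcoe : ∀ L : Matrix V V R, (L.charpolyRev : R⟦X⟧) =
      (1 - (X : R⟦X⟧) • L.map (C (R := R))).det := by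
    intro L
    rw [Matrix.charpolyRev, ← Polynomial.coeToPowerSeries.ringHom_apply, RingHom.map_det]
    congr 1
    ext1 i j
    by_cases hij : i = j <;> simp [hij, (commute_X (C _)).eq]
  have hSN : S * N = 1 := by
    ext u v s
    rw [hS, sub_mul, one_mul, Matrix.smul_mul, Matrix.sub_apply, Matrix.smul_apply, map_sub,
      smul_eq_mul]
    cases s with
    | zero =>
      by_cases huv : u = v <;> simp [hN, huv, Matrix.one_apply]
    | succ s =>
      rw [coeff_succ_X_mul, Matrix.mul_apply, map_sum, Matrix.one_apply]
      have : coeff (s + 1) (if u = v then (1 : R⟦X⟧) else 0) = 0 := by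
        split_ifs <;> simp [coeff_one]
      rw [this, sub_eq_zero]
      simp [hN, pow_succ', Matrix.mul_apply]
  -- `N` is the inverse of `S`, so subtracting `X J` factors as `S` times a rank-one perturbation of
  -- the identity.
  have hsplit : 1 - (X : R⟦X⟧) • (Matrix.of (fun _ _ => (1 : R)) + M).map (C (R := R)) =
      S * (1 + Matrix.replicateCol Unit (fun u => -X * ∑ v, N u v) *
        Matrix.replicateRow Unit (fun _ : V => (1 : R⟦X⟧))) := by
    have h1 : Matrix.replicateCol Unit (fun u => -X * ∑ v, N u v) *
        Matrix.replicateRow Unit (fun _ : V => (1 : R⟦X⟧)) =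
        N * Matrix.of (fun _ _ => -X) := by
      ext1 u v
      simp [Matrix.mul_apply, Finset.mul_sum, mul_comm]
    rw [mul_add, mul_one, h1, ← mul_assoc, hSN, one_mul, hS]
    ext1 u v
    simp
    ring
  rw [hcoe, hcoe, hsplit, Matrix.det_mul, Matrix.det_one_add_replicateCol_mul_replicateRow]
  congr 1
  have h2 : (PowerSeries.mk fun s => ∑ u, ∑ v, (M ^ s) u v) = ∑ u, ∑ v, N u v := by
    ext s
    simp [hN]
  rw [h2]
  simp [dotProduct, Finset.mul_sum, Finset.sum_neg_distrib, sub_eq_add_neg]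

theorem charpolyRev_ones_add_coeff_succ (M : Matrix V V R) (i : ℕ) :
    (Matrix.of (fun _ _ => (1 : R)) + M).charpolyRev.coeff (i + 1) =
      M.charpolyRev.coeff (i + 1) -
        ∑ s ∈ Finset.range (i + 1), M.charpolyRev.coeff (i - s) * ∑ u, ∑ v, (M ^ s) u v := by
  have h := congrArg (PowerSeries.coeff (i + 1)) (coe_charpolyRev_ones_add M)
  rw [mul_sub, mul_one, mul_left_comm, map_sub, PowerSeries.coeff_succ_X_mul, Polynomial.coeff_coe,
    Polynomial.coeff_coe, mul_comm (M.charpolyRev : PowerSeries R), PowerSeries.coeff_mul,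
    Finset.Nat.sum_antidiagonal_eq_sum_range_succ_mk] at h
  simpa [mul_comm] using h

/-- A symmetric integer matrix with zero diagonal has even characteristic coefficients in odd
degrees. -/
theorem even_charpolyRev_coeff_odd {A : Matrix V V ℤ} (hA : A.IsSymm) (h0 : ∀ u, A u u = 0)
    (j : ℕ) : Even (A.charpolyRev.coeff (2 * j + 1)) := by
  let e := Fintype.equivFin V
  -- Flipping signs below the diagonal gives a skew-symmetric matrix equal to `A` modulo 2; `K` and
  -- `-K` share their characteristic polynomial, so its odd coefficients vanish.
  let K : Matrix V V ℤ := Matrix.of fun u v => if e u < e v then A u v else -A u v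
  have hK : K.transpose = (-1 : ℤ) • K := by
    ext u v
    rcases lt_trichotomy (e u) (e v) with h | h | h
    · simp [K, h, h.not_gt, hA.apply u v]
    · rw [e.injective h]
      simp [K, h0]
    · simp [K, h, h.not_gt, hA.apply u v]
  have hmod : A.map (Int.castRingHom (ZMod 2)) = K.map (Int.castRingHom (ZMod 2)) := by
    ext u v
    simp only [Matrix.map_apply, K, Matrix.of_apply]
    split_ifs
    · rfl
    · rw [map_neg, CharTwo.neg_eq]
  have h1 : K.charpolyRev.coeff (2 * j + 1) = 0 := by
    have h := congrArg (fun p => p.coeff (2 * j + 1)) (charpolyRev_transpose K)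
    simp only [hK, charpolyRev_smul_coeff] at h
    rw [Odd.neg_one_pow ⟨j, rfl⟩] at h
    linarith
  have h2 := congrArg (fun L => L.charpolyRev.coeff (2 * j + 1)) hmod
  simp only [map_charpolyRev, Polynomial.coeff_map, h1, map_zero] at h2
  rw [even_iff_two_dvd]
  exact (ZMod.intCast_zmod_eq_zero_iff_dvd _ 2).1 h2

end CharpolyRev

theorem sum_mul_apply_col {V R : Type*} [Fintype V] [CommSemiring R]
    (M N : Matrix V V R) (q : V) :
    ∑ u, (M * N) u q = ∑ p, (∑ u, M u p) * N p q := by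
  simp only [Matrix.mul_apply, Finset.sum_mul]
  exact Finset.sum_comm

/-! ### Coefficients of `J - 2A` modulo powers of 2 -/

section EulerGraph

variable {V : Type*} [Fintype V] [DecidableEq V] (G : SimpleGraph V) [DecidableRel G.Adj]

/-- The coefficient of `x ^ (n - j)` in the characteristic polynomial of the adjacency matrix. -/
noncomputable def adjCoeff (j : ℕ) : ℤ := (G.adjMatrix ℤ).charpolyRev.coeff j

/-- The number of walks of length `j`. -/
def walkCount (j : ℕ) : ℤ := ∑ u, ∑ v, (G.adjMatrix ℤ ^ j) u v

theorem adjCoeff_zero : adjCoeff G 0 = 1 := charpolyRev_coeff_zero _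

theorem adjCoeff_one : adjCoeff G 1 = 0 := by
  rw [adjCoeff, Matrix.coeff_charpolyRev_eq_neg_trace, SimpleGraph.trace_adjMatrix, neg_zero]

theorem even_adjCoeff_odd (j : ℕ) : Even (adjCoeff G (2 * j + 1)) :=
  even_charpolyRev_coeff_odd (SimpleGraph.isSymm_adjMatrix G) (by simp) j

theorem walkCount_zero : walkCount G 0 = Fintype.card V := by
  simp [walkCount, Matrix.one_apply]

theorem walkCount_one : walkCount G 1 = -2 * adjCoeff G 2 := by
  have h1 : walkCount G 1 = (G.adjMatrix ℤ ^ 2).trace := by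
    simp only [walkCount, Matrix.trace, pow_two, pow_one, Matrix.diag_apply, Matrix.mul_apply,
      SimpleGraph.adjMatrix_apply]
    refine Finset.sum_congr rfl fun u _ => Finset.sum_congr rfl fun v _ => ?_
    by_cases h : G.Adj u v <;> simp [h, G.adj_comm v u]
  have h2 := trace_pow_eq_sum_coeff (SimpleGraph.isSymm_adjMatrix (α := ℤ) G) two_pos
  have hc1 : (G.adjMatrix ℤ).charpolyRev.coeff 1 = 0 := adjCoeff_one G
  have hc0 : (G.adjMatrix ℤ).charpolyRev.coeff 0 = 1 := adjCoeff_zero G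
  have hsq : ((1 - (G.adjMatrix ℤ).charpolyRev) ^ 2).coeff 2 = 0 := by
    rw [pow_two, Polynomial.coeff_mul, Finset.Nat.sum_antidiagonal_eq_sum_range_succ_mk]
    simp [Finset.sum_range_succ, hc1, hc0, Polynomial.coeff_one]
  rw [show Finset.Icc 1 2 = {1, 2} from rfl, Finset.sum_pair (by norm_num), hsq] at h2
  rw [h1, adjCoeff]
  have h3 : ((G.adjMatrix ℤ ^ 2).trace : ℚ) =
      ((-2 * (G.adjMatrix ℤ).charpolyRev.coeff 2 : ℤ) : ℚ) := by
    rw [h2]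
    simp [Polynomial.coeff_one]
  exact_mod_cast h3

variable {G}

/-- Summing over the first and last steps leaves `∑ deg(p) (A^j)_{pq} deg(q)`, with two even factors
in each term. -/
theorem walkCount_dvd (hG : IsEulerGraph G) (j : ℕ) : 4 ∣ walkCount G (j + 2) := by
  have hrow : ∀ u, ∑ v, G.adjMatrix ℤ u v = G.degree u := by
    intro u
    simp [SimpleGraph.adjMatrix_apply, ← SimpleGraph.card_neighborFinset_eq_degree,
      SimpleGraph.neighborFinset_eq_filter]
  have hcol : ∀ v, ∑ u, G.adjMatrix ℤ u v = G.degree v := by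
    intro v
    rw [← hrow v]
    exact Finset.sum_congr rfl fun u _ => (SimpleGraph.isSymm_adjMatrix (α := ℤ) G).apply v u
  have h : walkCount G (j + 2) =
      ∑ q, ∑ p, (G.degree p : ℤ) * (G.adjMatrix ℤ ^ j) p q * (G.degree q : ℤ) := by
    have h1 : walkCount G (j + 2) = ∑ v, ∑ u,
        (G.adjMatrix ℤ * G.adjMatrix ℤ ^ j * G.adjMatrix ℤ) u v := by
      rw [walkCount, pow_succ, pow_succ']
      exact Finset.sum_comm
    rw [h1]
    simp only [sum_mul_apply_col, hcol]
    rw [Finset.sum_comm]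
    simp only [← Finset.mul_sum, hrow]
    simp only [Finset.sum_mul]
  rw [h]
  refine Finset.dvd_sum fun q _ => Finset.dvd_sum fun p _ => ?_
  obtain ⟨c, hc⟩ := hG p
  obtain ⟨d, hd⟩ := hG q
  rw [hc, hd]
  exact ⟨c * (G.adjMatrix ℤ ^ j) p q * d, by push_cast; ring⟩

theorem charpolyRev_allOnesSubTwoAdj_coeff_succ (i : ℕ) :
    (allOnesSubTwoAdj G).charpolyRev.coeff (i + 1) = (-2) ^ (i + 1) * adjCoeff G (i + 1) -
      (-2) ^ i * ∑ s ∈ Finset.range (i + 1), adjCoeff G (i - s) * walkCount G s := by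
  have h : allOnesSubTwoAdj G = Matrix.of (fun _ _ => (1 : ℤ)) + (-2 : ℤ) • G.adjMatrix ℤ := by
    rw [allOnesSubTwoAdj, neg_smul, sub_eq_add_neg]
  rw [h, charpolyRev_ones_add_coeff_succ, charpolyRev_smul_coeff, Finset.mul_sum]
  congr 1
  refine Finset.sum_congr rfl fun s hs => ?_
  have hsi : s ≤ i := Nat.lt_succ_iff.1 (Finset.mem_range.1 hs)
  have hp : (-2 : ℤ) ^ i = (-2) ^ (i - s) * (-2) ^ s := by rw [← pow_add, Nat.sub_add_cancel hsi]
  simp only [charpolyRev_smul_coeff, smul_pow, Matrix.smul_apply, smul_eq_mul, ← Finset.mul_sum,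
    adjCoeff, walkCount, hp]
  ring

theorem exists_sum_adjCoeff_mul_walkCount (hG : IsEulerGraph G) (i : ℕ) :
    ∃ z, ∑ s ∈ Finset.range (i + 2), adjCoeff G (i + 1 - s) * walkCount G s =
      Fintype.card V * adjCoeff G (i + 1) + -2 * adjCoeff G 2 * adjCoeff G i + 4 * z := by
  rw [Finset.sum_range_succ', Finset.sum_range_succ']
  choose w hw using walkCount_dvd hG
  refine ⟨∑ s ∈ Finset.range i, adjCoeff G (i + 1 - (s + 1 + 1)) * w s, ?_⟩
  simp only [add_assoc, Nat.reduceAdd, hw, walkCount_one, walkCount_zero, zero_add,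
    Nat.add_sub_cancel, Nat.sub_zero, Finset.mul_sum, mul_left_comm _ (4 : ℤ)]
  ring

/-- Besides `n b_(2j)`, the terms not visibly divisible by 4 are twice a multiple of an odd-index
`b`, which is even. -/
theorem exists_coeff_odd (hG : IsEulerGraph G) (j : ℕ) :
    ∃ z, (allOnesSubTwoAdj G).charpolyRev.coeff (2 * j + 1) =
      -2 ^ (2 * j) * (Fintype.card V * adjCoeff G (2 * j) + 4 * z) := by
  rw [charpolyRev_allOnesSubTwoAdj_coeff_succ]
  obtain ⟨b, hb⟩ := even_adjCoeff_odd G j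
  have hpow : (-2 : ℤ) ^ (2 * j) = 2 ^ (2 * j) := Even.neg_pow ⟨j, by ring⟩ 2
  rw [pow_succ, hpow, hb]
  cases j with
  | zero =>
    refine ⟨b, ?_⟩
    simp [adjCoeff_zero, walkCount_zero]
    ring
  | succ j =>
    obtain ⟨z, hz⟩ := exists_sum_adjCoeff_mul_walkCount hG (2 * j + 1)
    obtain ⟨c, hc⟩ := even_adjCoeff_odd G j
    rw [show 2 * (j + 1) + 1 = 2 * j + 1 + 2 by ring, show 2 * (j + 1) = 2 * j + 1 + 1 by ring,
      hz, hc]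
    exact ⟨b - adjCoeff G 2 * c + z, by ring⟩

/-- After division by `2^(2j+1)`, the middle coefficient contributes `2 b_(2j+2) + n b_(2j+1) - 2
b_2 b_(2j)` modulo 4. The outer coefficient cancels the first term and the product cancels the last,
because `n` is odd; and `n b_(2j+1) ≡ -b_(2j+1)` modulo 4, because `b_(2j+1)` is even. -/
theorem exists_coeff_combination (hn : Odd (Fintype.card V)) (hG : IsEulerGraph G) (j : ℕ) :
    ∃ z, (allOnesSubTwoAdj G).charpolyRev.coeff (2 * j + 3) +
      (allOnesSubTwoAdj G).charpolyRev.coeff (2 * j + 2) +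
      (allOnesSubTwoAdj G).charpolyRev.coeff (2 * j + 1) *
        (allOnesSubTwoAdj G).charpolyRev.coeff 3 =
      2 ^ (2 * j + 1) * (-adjCoeff G (2 * j + 1) + 4 * z) := by
  obtain ⟨z1, h1⟩ := exists_coeff_odd hG (j + 1)
  obtain ⟨z2, h2⟩ := exists_coeff_odd hG j
  obtain ⟨z3, h3⟩ := exists_coeff_odd hG 1
  obtain ⟨z4, h4⟩ := exists_sum_adjCoeff_mul_walkCount hG (2 * j)
  have h5 := charpolyRev_allOnesSubTwoAdj_coeff_succ (G := G) (2 * j + 1)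
  obtain ⟨b, hb⟩ := even_adjCoeff_odd G j
  obtain ⟨m, hm⟩ := hn
  have hpow : (-2 : ℤ) ^ (2 * j) = 2 ^ (2 * j) := Even.neg_pow ⟨j, by ring⟩ 2
  rw [show 2 * (j + 1) + 1 = 2 * j + 3 by ring, show 2 * (j + 1) = 2 * j + 2 by ring] at h1
  norm_num at h3
  simp only [add_assoc, Nat.reduceAdd] at h4 h5
  rw [h1, h2, h3, h5, h4, hm, hb, pow_add, pow_add, pow_add, hpow]
  refine ⟨-m * adjCoeff G (2 * j + 2) - 2 * z1 + (m + 1) * b +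
    (2 * m ^ 2 + 2 * m) * adjCoeff G (2 * j) * adjCoeff G 2 +
    2 * (2 * m + 1) * (adjCoeff G (2 * j) * z3 + z2 * adjCoeff G 2) + 8 * z2 * z3 + z4, ?_⟩
  push_cast
  ring

end EulerGraph

/-- The bound `i ≤ n` matters: `HasCharCoeffs` leaves `a` arbitrary beyond `n`. -/
theorem HasCharCoeffs.eq_coeff {V : Type*} [Fintype V] [DecidableEq V] {M : Matrix V V ℤ}
    {n : ℕ} {a : ℕ → ℤ} (ha : HasCharCoeffs M n a) (hV : Fintype.card V = n) {i : ℕ}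
    (hi : i ≤ n) : a i = M.charpolyRev.coeff i := by
  rw [← Matrix.reverse_charpoly, Polynomial.coeff_reverse, Matrix.charpoly_natDegree_eq_dim, hV,
    Polynomial.revAt_le hi, ha, Polynomial.finsetSum_coeff]
  simp only [Polynomial.coeff_C_mul_X_pow]
  rw [Finset.sum_eq_single i]
  · simp
  · intro k hk hki
    rw [if_neg]
    have := Finset.mem_range.1 hk
    omega
  · intro h
    exact absurd (Finset.mem_range.2 (by omega)) h

/-! ### The necklace sum -/

section NecklaceSum

theorem waringSum_congr {d : ℕ} {x y : ℕ → ℚ} (h : ∀ j ∈ Finset.Icc 1 d, x j = y j) :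
    waringSum d x = waringSum d y := by
  refine Finset.sum_congr rfl fun m _ => ?_
  congr 1
  exact Finset.prod_congr rfl fun j hj => by rw [h j hj]

/-- The rotation-averaged combination of the power sums with index dividing `2k`. -/
noncomputable def necklaceSum (k : ℕ) (x : ℕ → ℚ) : ℚ :=
  ∑ d ∈ (2 * k).divisors,
    ((d : ℚ) * (Nat.totient (2 * k / d) : ℚ)) / (2 * (k : ℚ)) * waringSum d x

/-- For even `e`, the totient of the 2-part is half of it, so `φ(e)/e` has at most one factor 2 in
its denominator. -/
theorem two_mul_totient_div_mem_oddDenSubring {e : ℕ} (he : e ≠ 0) :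
    2 * (e.totient : ℚ) / e ∈ oddDenSubring := by
  obtain ⟨v, m, hm, rfl⟩ := Nat.exists_eq_two_pow_mul_odd he
  have h0 : m ≠ 0 := by rintro rfl; simp at hm
  cases v with
  | zero =>
    rw [pow_zero, one_mul, div_eq_mul_inv]
    exact mul_mem (mul_mem (natCast_mem _ 2) (natCast_mem _ _)) (inv_natCast_mem_oddDenSubring hm)
  | succ v =>
    have hc : Nat.Coprime (2 ^ (v + 1)) m := (Nat.coprime_two_left.2 hm).pow_left _
    rw [Nat.totient_mul hc, Nat.totient_prime_pow_succ Nat.prime_two]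
    have : 2 * ((2 ^ v * (2 - 1) * m.totient : ℕ) : ℚ) / ((2 ^ (v + 1) * m : ℕ) : ℚ) =
        (m.totient : ℚ) * (m : ℚ)⁻¹ := by
      push_cast
      field_simp
      ring
    rw [this]
    exact mul_mem (natCast_mem _ _) (inv_natCast_mem_oddDenSubring hm)

/-- Congruent arguments modulo `4` give congruent necklace sums modulo `2`. -/
theorem necklaceSum_sub_mem {k : ℕ} (hk : 0 < k) {x y : ℕ → ℚ}
    (hx : ∀ j ∈ Finset.Icc 1 (2 * k), x j ∈ oddDenSubring)
    (hxy : ∀ j ∈ Finset.Icc 1 (2 * k), ∃ u ∈ oddDenSubring, y j = x j + 4 * u) :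
    ∃ z ∈ oddDenSubring, necklaceSum k y - necklaceSum k x = 2 * z := by
  choose! u hu hy using hxy
  let x' : ℕ → oddDenSubring := fun j =>
    if h : j ∈ Finset.Icc 1 (2 * k) then ⟨x j, hx j h⟩ else 0
  let u' : ℕ → oddDenSubring := fun j =>
    if h : j ∈ Finset.Icc 1 (2 * k) then ⟨u j, hu j h⟩ else 0
  have hterm : ∀ d ∈ (2 * k).divisors, ∃ z ∈ oddDenSubring,
      ((d : ℚ) * (Nat.totient (2 * k / d) : ℚ)) / (2 * (k : ℚ)) * waringSum d y -
      ((d : ℚ) * (Nat.totient (2 * k / d) : ℚ)) / (2 * (k : ℚ)) * waringSum d x = 2 * z := by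
    intro d hd
    obtain ⟨⟨e, he⟩, -⟩ := Nat.mem_divisors.1 hd
    have hd0 : 0 < d := Nat.pos_of_mem_divisors hd
    have he0 : e ≠ 0 := by rintro rfl; omega
    have hdk : d ≤ 2 * k := Nat.divisor_le hd
    have hsub : ∀ j ∈ Finset.Icc 1 d, j ∈ Finset.Icc 1 (2 * k) := fun j hj =>
      Finset.Icc_subset_Icc_right hdk hj
    obtain ⟨z, hz⟩ := waringSum_add_four_mul hd0 x' u'
    rw [waringSum_congr (x := fun j => (x' j + 4 * u' j : ℚ)) (y := y) (fun j hj => by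
      simp only [x', u', dif_pos (hsub j hj), hy j (hsub j hj)]),
      waringSum_congr (x := fun j => (x' j : ℚ)) (y := x) (fun j hj => by
      simp only [x', dif_pos (hsub j hj)])] at hz
    -- With `2k = d e` the weight is `φ(e)/e`. It costs one of the two factors 2 gained from
    -- `waringSum_add_four_mul`.
    refine ⟨2 * (e.totient : ℚ) / e * z,
      mul_mem (two_mul_totient_div_mem_oddDenSubring he0) z.2, ?_⟩
    have hq : (2 * (k : ℚ)) = d * e := by exact_mod_cast he
    have hd0' : (d : ℚ) ≠ 0 := by positivity
    have he0' : (e : ℚ) ≠ 0 := by positivity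
    rw [← mul_sub, hz, he, Nat.mul_div_cancel_left _ hd0, hq]
    field_simp
    ring
  choose! z hz hzeq using hterm
  refine ⟨∑ d ∈ (2 * k).divisors, z d, sum_mem hz, ?_⟩
  rw [necklaceSum, necklaceSum, ← Finset.sum_sub_distrib, Finset.sum_congr rfl hzeq,
    Finset.mul_sum]

theorem weightedTuples_filter_ne_zero {d : ℕ} (hd : 0 < d) :
    {m ∈ weightedTuples d | ¬ m d = 0} = {Pi.single d 1} := by
  ext m
  rw [Finset.mem_filter, Finset.mem_singleton, mem_weightedTuples]
  constructor
  · rintro ⟨⟨h0, hs⟩, hm⟩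
    have hdm : d ∈ Finset.Icc 1 d := Finset.mem_Icc.2 ⟨hd, le_rfl⟩
    rw [← Finset.add_sum_erase _ _ hdm] at hs
    have h1 : d * 1 ≤ d * m d := Nat.mul_le_mul_left d (Nat.one_le_iff_ne_zero.2 hm)
    have hm1 : m d = 1 := by
      refine le_antisymm (Nat.le_of_mul_le_mul_left ?_ hd) (Nat.one_le_iff_ne_zero.2 hm)
      omega
    have hrest : ∑ j ∈ (Finset.Icc 1 d).erase d, j * m j = 0 := by
      rw [hm1] at hs
      omega
    ext j
    rcases eq_or_ne j d with rfl | hj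
    · rw [hm1, Pi.single_eq_same]
    · rw [Pi.single_eq_of_ne hj]
      by_cases hjd : j ∈ Finset.Icc 1 d
      · have := (Finset.sum_eq_zero_iff.1 hrest) j (Finset.mem_erase.2 ⟨hj, hjd⟩)
        have hj1 := (Finset.mem_Icc.1 hjd).1
        rcases Nat.mul_eq_zero.1 this with h | h
        · omega
        · exact h
      · exact h0 j hjd
  · rintro rfl
    refine ⟨⟨fun j hj => ?_, ?_⟩, by simp⟩
    · rw [Pi.single_eq_of_ne]
      rintro rfl
      exact hj (Finset.mem_Icc.2 ⟨hd, le_rfl⟩)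
    · rw [Finset.sum_eq_single d]
      · simp
      · intro j _ hj
        simp [Pi.single_eq_of_ne hj]
      · intro h
        exact absurd (Finset.mem_Icc.2 ⟨hd, le_rfl⟩) h

/-- The term of the necklace sum that involves the last variable. -/
theorem necklaceSum_eq_add {k : ℕ} (hk : 0 < k) (x : ℕ → ℚ) :
    necklaceSum k x = x (2 * k) + ∑ d ∈ (2 * k).divisors,
      ∑ m ∈ weightedTuples d with m (2 * k) = 0,
        ((d : ℚ) * (Nat.totient (2 * k / d) : ℚ)) / (2 * (k : ℚ)) *
          (((Nat.factorial ((∑ j ∈ Finset.Icc 1 d, m j) - 1) : ℚ) /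
            ∏ j ∈ Finset.Icc 1 d, (Nat.factorial (m j) : ℚ)) *
              ∏ j ∈ Finset.Icc 1 d, x j ^ m j) := by
  have h2k : 0 < 2 * k := by omega
  have hmem : 2 * k ∈ Finset.Icc 1 (2 * k) := Finset.mem_Icc.2 ⟨h2k, le_rfl⟩
  have hk0 : (k : ℚ) ≠ 0 := by positivity
  rw [necklaceSum, ← Finset.add_sum_erase _ _ (Nat.mem_divisors_self _ h2k.ne'),
    ← Finset.add_sum_erase (2 * k).divisors _ (Nat.mem_divisors_self _ h2k.ne'), ← add_assoc]
  congr 1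
  · rw [waringSum, ← Finset.sum_filter_add_sum_filter_not _ (fun m => m (2 * k) = 0), add_comm,
      mul_add, Finset.mul_sum, Finset.mul_sum, weightedTuples_filter_ne_zero h2k]
    congr 1
    rw [Finset.sum_singleton, Finset.sum_eq_single_of_mem _ hmem,
      Finset.prod_eq_single_of_mem _ hmem, Finset.prod_eq_single_of_mem _ hmem]
    · simp [Nat.div_self h2k]
      field_simp
    · intro j _ hj
      simp [Pi.single_eq_of_ne hj]
    · intro j _ hj
      simp [Pi.single_eq_of_ne hj]
    · intro j _ hj
      simp [Pi.single_eq_of_ne hj]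
  · refine Finset.sum_congr rfl fun d hd => ?_
    rw [waringSum, Finset.mul_sum, Finset.filter_true_of_mem]
    intro m hm
    refine ((mem_weightedTuples d m).1 hm).1 _ fun h => ?_
    have h1 := Nat.divisor_le (Finset.mem_of_mem_erase hd)
    exact (Finset.mem_erase.1 hd).1 (le_antisymm h1 (Finset.mem_Icc.1 h).2)

/-- An index `2k - 1` is only possible for `d = 2k`. It then occurs once, since `2(2k-1) > 2k`, and
the leftover weight 1 must come from `m_1`. -/
theorem exists_one_of_weightedTuples {k d : ℕ} (hk : 2 ≤ k) (hd : d ∣ 2 * k) {m : ℕ → ℕ}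
    (hm : m ∈ weightedTuples d) (h : m (2 * k - 1) ≠ 0) : m 1 ≠ 0 := by
  obtain ⟨h0, hs⟩ := (mem_weightedTuples d m).1 hm
  have hmem : 2 * k - 1 ∈ Finset.Icc 1 d := by
    by_contra hc
    exact h (h0 _ hc)
  have hd1 := (Finset.mem_Icc.1 hmem).2
  have hdeq : d = 2 * k := by
    obtain ⟨e, he⟩ := hd
    have : e < 2 := by
      by_contra hc
      have : d * 2 ≤ d * e := Nat.mul_le_mul_left d (by omega)
      omega
    interval_cases e <;> omega
  rw [← Finset.add_sum_erase _ _ hmem] at hs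
  have h1 : m (2 * k - 1) = 1 := by
    by_contra hc
    have : (2 * k - 1) * 2 ≤ (2 * k - 1) * m (2 * k - 1) := Nat.mul_le_mul_left _ (by omega)
    omega
  have hrest : ∑ j ∈ (Finset.Icc 1 d).erase (2 * k - 1), j * m j = 1 := by
    rw [h1] at hs
    omega
  obtain ⟨j, hj, hj0⟩ := Finset.exists_ne_zero_of_sum_ne_zero (hrest.trans_ne one_ne_zero)
  have hle := Finset.single_le_sum (f := fun j => j * m j) (fun _ _ => Nat.zero_le _) hj
  rw [hrest] at hle
  have hj1 : j * m j = 1 := by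
    change j * m j ≤ 1 at hle
    omega
  obtain ⟨rfl, hm1⟩ := mul_eq_one.1 hj1
  omega

/-- When the first variable vanishes, the last two variables enter the necklace sum through a
single linear term. -/
theorem necklaceSum_eq_add_of_one_eq_zero {k : ℕ} (hk : 2 ≤ k) {x : ℕ → ℚ} (hx : x 1 = 0) :
    necklaceSum k x = x (2 * k) + necklaceSum k fun j => if j < 2 * k - 1 then x j else 0 := by
  rw [necklaceSum_eq_add (by omega), necklaceSum_eq_add (by omega), if_neg (by omega), zero_add]
  congr 1
  refine Finset.sum_congr rfl fun d hd => Finset.sum_congr rfl fun m hm => ?_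
  obtain ⟨hm, hm0⟩ := Finset.mem_filter.1 hm
  have hdvd := Nat.dvd_of_mem_divisors hd
  have hd0 := Nat.pos_of_mem_divisors hd
  have hdk : d ≤ 2 * k := Nat.divisor_le hd
  congr 2
  by_cases h : m (2 * k - 1) = 0
  · refine Finset.prod_congr rfl fun j hj => ?_
    split_ifs with hjk
    · rfl
    · have := (Finset.mem_Icc.1 hj).2
      obtain rfl | rfl : j = 2 * k - 1 ∨ j = 2 * k := by omega
      · rw [h, pow_zero, pow_zero]
      · rw [hm0, pow_zero, pow_zero]
  · have h1 := exists_one_of_weightedTuples hk hdvd hm h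
    have hmem : 1 ∈ Finset.Icc 1 d := Finset.mem_Icc.2 ⟨le_rfl, hd0⟩
    rw [Finset.prod_eq_zero hmem, Finset.prod_eq_zero hmem]
    · rw [if_pos (by omega), hx, zero_pow h1]
    · rw [hx, zero_pow h1]

theorem prod_Icc_eq_even_mul_odd {M : Type*} [CommMonoid M] (f : ℕ → M) (t : ℕ) :
    ∏ j ∈ Finset.Icc 1 (2 * t + 1), f j =
      (∏ j ∈ Finset.Icc 1 t, f (2 * j)) * ∏ j ∈ Finset.Icc 1 (t + 1), f (2 * j - 1) := by
  induction t with
  | zero => simp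
  | succ t ih =>
    have h1 : ∏ j ∈ Finset.Icc 1 (t + 1), f (2 * j) =
        (∏ j ∈ Finset.Icc 1 t, f (2 * j)) * f (2 * t + 1 + 1) :=
      Finset.prod_Icc_succ_top (by omega) _
    have h2 : ∏ j ∈ Finset.Icc 1 (t + 1 + 1), f (2 * j - 1) =
        (∏ j ∈ Finset.Icc 1 (t + 1), f (2 * j - 1)) * f (2 * t + 1 + 1 + 1) :=
      Finset.prod_Icc_succ_top (by omega) _
    rw [show 2 * (t + 1) + 1 = 2 * t + 1 + 1 + 1 by ring, Finset.prod_Icc_succ_top (by omega),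
      Finset.prod_Icc_succ_top (by omega), ih, h1, h2, mul_mul_mul_comm, mul_assoc]

/-- The `2`-adic approximation of the negated characteristic coefficients of `A` by those of
`J - 2A`. -/
noncomputable def approxCoeff (n : ℕ) (a : ℕ → ℤ) (j : ℕ) : ℚ :=
  if Even j then (a (j + 1) : ℚ) / (2 ^ j * (n : ℚ))
  else ((a (j + 2) : ℚ) + (a (j + 1) : ℚ) + (a j : ℚ) * (a 3 : ℚ)) / 2 ^ j

theorem prodP_eq_prod_approxCoeff (n : ℕ) (a : ℕ → ℤ) {d : ℕ} {m : ℕ → ℕ}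
    (hm : m ∈ weightedTuples d) :
    prodP n a d m = ∏ j ∈ Finset.Icc 1 d, approxCoeff n a j ^ m j := by
  -- For even `d` the range gains the index `d + 1`, where `m` vanishes.
  have h : ∏ j ∈ Finset.Icc 1 d, approxCoeff n a j ^ m j =
      ∏ j ∈ Finset.Icc 1 (2 * (d / 2) + 1), approxCoeff n a j ^ m j := by
    refine Finset.prod_subset (Finset.Icc_subset_Icc_right (by omega)) fun j _ hj => ?_
    rw [((mem_weightedTuples d m).1 hm).1 j hj, pow_zero]
  rw [h, prod_Icc_eq_even_mul_odd, prodP]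
  congr 1
  · refine Finset.prod_congr rfl fun j _ => ?_
    rw [approxCoeff, if_pos (even_two_mul j)]
  · refine Finset.prod_congr rfl fun j hj => ?_
    obtain ⟨i, rfl⟩ : ∃ i, j = i + 1 := ⟨j - 1, by have := (Finset.mem_Icc.1 hj).1; omega⟩
    rw [show 2 * (i + 1) - 1 = 2 * i + 1 by omega, approxCoeff,
      if_neg (Nat.not_even_iff_odd.2 ⟨i, rfl⟩)]
    rfl

theorem sum_coeffC_mul_prodP {k : ℕ} (hk : 0 < k) (n : ℕ) (a : ℕ → ℤ) :
    ∑ d ∈ Nat.divisors (2 * k), ∑ m ∈ weightedTuples d with m (2 * k) = 0,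
      coeffC k d m * prodP n a d m =
    2 ^ (2 * k) * (necklaceSum k (approxCoeff n a) - approxCoeff n a (2 * k)) := by
  rw [necklaceSum_eq_add hk, add_sub_cancel_left, Finset.mul_sum]
  refine Finset.sum_congr rfl fun d _ => ?_
  rw [Finset.mul_sum]
  refine Finset.sum_congr rfl fun m hm => ?_
  rw [prodP_eq_prod_approxCoeff n a (Finset.mem_filter.1 hm).1, coeffC]
  ring

end NecklaceSum

/-! ### Evenness of the necklace sum and approximation modulo 4 -/

section EulerGraph

variable {V : Type*} [Fintype V] [DecidableEq V] {G : SimpleGraph V} [DecidableRel G.Adj]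

theorem exists_necklaceSum_adjCoeff (hG : IsEulerGraph G) {k : ℕ} (hk : 2 ≤ k) :
    ∃ z : ℤ, necklaceSum k (fun j => -(adjCoeff G j : ℚ)) = 2 * z := by
  obtain ⟨z, hz⟩ := exists_sum_totient_mul_trace_add G k (by omega)
  obtain ⟨w, hw⟩ := walkCount_dvd hG (k - 2)
  rw [Nat.sub_add_cancel hk] at hw
  change _ + k * walkCount G k = _ at hz
  rw [hw] at hz
  refine ⟨z - w, ?_⟩
  have hk0 : (k : ℚ) ≠ 0 := by positivity
  have h1 : necklaceSum k (fun j => -(adjCoeff G j : ℚ)) * (2 * k) =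
      ((∑ d ∈ (2 * k).divisors,
        ((2 * k / d).totient : ℤ) * (G.adjMatrix ℤ ^ d).trace : ℤ) : ℚ) := by
    rw [necklaceSum, Finset.sum_mul]
    push_cast
    refine Finset.sum_congr rfl fun d hd => ?_
    rw [trace_pow_eq_mul_waringSum (SimpleGraph.isSymm_adjMatrix G) (Nat.pos_of_mem_divisors hd)]
    simp only [adjCoeff]
    field_simp
  rw [eq_sub_of_add_eq hz] at h1
  push_cast at h1 ⊢
  have : (necklaceSum k (fun j => -(adjCoeff G j : ℚ)) - 2 * (z - w)) * (2 * k) = 0 := by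
    rw [sub_mul, h1]
    ring
  rcases mul_eq_zero.1 this with h | h
  · linarith
  · exact absurd h (by positivity)

variable {n : ℕ} {a : ℕ → ℤ}

/-- The bound on `j` keeps the largest coefficient index in use, `j + 1` for even `j` and `j + 2`
for odd `j`, at most `n`. -/
theorem exists_approxCoeff_eq (hn : Odd n) (hV : Fintype.card V = n) (hG : IsEulerGraph G)
    (ha : HasCharCoeffs (allOnesSubTwoAdj G) n a) {j : ℕ} (hj : j + (j % 2) + 1 ≤ n) :
    ∃ u ∈ oddDenSubring, approxCoeff n a j = -(adjCoeff G j : ℚ) + 4 * u := by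
  rcases Nat.even_or_odd' j with ⟨i, rfl | rfl⟩
  · obtain ⟨z, hz⟩ := exists_coeff_odd hG i
    rw [approxCoeff, if_pos (even_two_mul i), ha.eq_coeff hV (by omega), hz, hV]
    have hn0 : (n : ℚ) ≠ 0 := by
      have := hn.pos
      positivity
    refine ⟨-z * (n : ℚ)⁻¹, mul_mem (neg_mem (intCast_mem _ z))
      (inv_natCast_mem_oddDenSubring hn), ?_⟩
    push_cast
    field_simp
    ring
  · obtain ⟨z, hz⟩ := exists_coeff_combination (hV ▸ hn) hG i
    rw [approxCoeff, if_neg (Nat.not_even_iff_odd.2 ⟨i, rfl⟩), ha.eq_coeff hV (by omega),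
      ha.eq_coeff hV (by omega), ha.eq_coeff hV (by omega), ha.eq_coeff hV (by omega)]
    refine ⟨z, intCast_mem _ z, ?_⟩
    rw [div_eq_iff (by positivity)]
    have h1 := congrArg (Int.cast : ℤ → ℚ) hz
    push_cast at h1
    linarith

theorem four_dvd_sub_of_two_pow_mul_modEq {p q : ℕ} (hpq : p + 2 ≤ q) {s t : ℤ}
    (h : 2 ^ p * s ≡ 2 ^ p * t [ZMOD 2 ^ q]) : 4 ∣ s - t := by
  obtain ⟨e, rfl⟩ := Nat.exists_eq_add_of_le hpq
  obtain ⟨c, hc⟩ := h.symm.dvd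
  refine ⟨2 ^ e * c, mul_left_cancel₀ (pow_ne_zero p (two_ne_zero (α := ℤ))) ?_⟩
  rw [mul_sub, hc]
  ring

/-- The range stops before `2k - 1`, whose approximation would involve the unknown `a_(2k+1)`. -/
theorem four_dvd_adjCoeff_sub (hn : Odd n) (hV : Fintype.card V = n) (hG : IsEulerGraph G)
    (ha : HasCharCoeffs (allOnesSubTwoAdj G) n a) {H : SimpleGraph V} [DecidableRel H.Adj]
    (hH : IsEulerGraph H) {c : ℕ → ℤ} (hc : HasCharCoeffs (allOnesSubTwoAdj H) n c) {k : ℕ}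
    (hkn : 2 * k + 1 ≤ n)
    (hac : ∀ i : ℕ, 3 ≤ i → i ≤ 2 * k → a i ≡ c i [ZMOD 2 ^ (2 * k + 1)])
    {j : ℕ} (hj1 : 1 ≤ j) (hj : j < 2 * k - 1) : 4 ∣ adjCoeff G j - adjCoeff H j := by
  rcases Nat.even_or_odd' j with ⟨i, rfl | rfl⟩
  · obtain ⟨z, hz⟩ := exists_coeff_odd hG i
    obtain ⟨w, hw⟩ := exists_coeff_odd hH i
    have h := hac (2 * i + 1) (by omega) (by omega)
    rw [ha.eq_coeff hV (by omega), hc.eq_coeff hV (by omega), hz, hw, neg_mul, neg_mul,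
      Int.neg_modEq_neg] at h
    have h4 := four_dvd_sub_of_two_pow_mul_modEq (by omega) h
    have h5 : (4 : ℤ) ∣ (Fintype.card V : ℤ) * (adjCoeff G (2 * i) - adjCoeff H (2 * i)) := by
      have : (Fintype.card V : ℤ) * (adjCoeff G (2 * i) - adjCoeff H (2 * i)) =
          (Fintype.card V * adjCoeff G (2 * i) + 4 * z -
            (Fintype.card V * adjCoeff H (2 * i) + 4 * w)) + 4 * (w - z) := by ring
      rw [this]
      exact dvd_add h4 (dvd_mul_right _ _)
    refine IsCoprime.dvd_of_dvd_mul_left ?_ h5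
    rw [show (4 : ℤ) = 2 ^ 2 by norm_num]
    refine IsCoprime.pow_left ?_
    rw [Int.isCoprime_iff_gcd_eq_one, hV]
    exact Nat.coprime_two_left.2 hn
  -- The index 1 is separate: its combination involves `a_1` and `a_2`, about which nothing is
  -- assumed, but `b_1 = 0`.
  · rcases Nat.eq_zero_or_pos i with rfl | hi
    · simp [adjCoeff_one]
    obtain ⟨z, hz⟩ := exists_coeff_combination (hV ▸ hn) hG i
    obtain ⟨w, hw⟩ := exists_coeff_combination (hV ▸ hn) hH i
    rw [← ha.eq_coeff hV (by omega), ← ha.eq_coeff hV (by omega), ← ha.eq_coeff hV (by omega),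
      ← ha.eq_coeff hV (by omega)] at hz
    rw [← hc.eq_coeff hV (by omega), ← hc.eq_coeff hV (by omega), ← hc.eq_coeff hV (by omega),
      ← hc.eq_coeff hV (by omega)] at hw
    have h := ((hac (2 * i + 3) (by omega) (by omega)).add
      (hac (2 * i + 2) (by omega) (by omega))).add ((hac (2 * i + 1) (by omega) (by omega)).mul
      (hac 3 (by omega) (by omega)))
    rw [hz, hw] at h
    have h4 := four_dvd_sub_of_two_pow_mul_modEq (by omega) h
    omega

end EulerGraph

/-! ### The main theorem -/

theorem mainTheorem10 {V : Type*} [Fintype V] [DecidableEq V]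
    (n : ℕ) (hn : Odd n) (hV : Fintype.card V = n)
    (G : SimpleGraph V) [DecidableRel G.Adj] (hG : IsEulerGraph G)
    (a : ℕ → ℤ) (ha : HasCharCoeffs (allOnesSubTwoAdj G) n a)
    (k : ℕ) (hk : 2 ≤ k) (hkn : k ≤ (n - 1) / 2) :
    RatModTwoPow (2 * k + 1) (a (2 * k + 1) : ℚ)
      (∑ d ∈ Nat.divisors (2 * k), ∑ m ∈ weightedTuples d with m (2 * k) = 0,
        coeffC k d m * prodP n a d m) ∧
    (∀ (H : SimpleGraph V) [DecidableRel H.Adj], IsEulerGraph H →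
      ∀ c : ℕ → ℤ, HasCharCoeffs (allOnesSubTwoAdj H) n c →
        (∀ i : ℕ, 3 ≤ i → i ≤ 2 * k → a i ≡ c i [ZMOD 2 ^ (2 * k + 1)]) →
          a (2 * k + 1) ≡ c (2 * k + 1) [ZMOD 2 ^ (2 * k + 1)]) := by
  have hk0 : 0 < k := by omega
  have hkn' : 2 * k + 1 ≤ n := by omega
  have hint : ∀ (L : SimpleGraph V) [DecidableRel L.Adj] (j : ℕ),
      -(adjCoeff L j : ℚ) ∈ oddDenSubring := fun L _ j => neg_mem (intCast_mem _ _)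
  constructor
  · rw [sum_coeffC_mul_prodP hk0, ratModTwoPow_iff]
    have happrox : ∀ j ∈ Finset.Icc 1 (2 * k), ∃ u ∈ oddDenSubring,
        approxCoeff n a j = -(adjCoeff G j : ℚ) + 4 * u := by
      intro j hj
      have := (Finset.mem_Icc.1 hj).2
      exact exists_approxCoeff_eq hn hV hG ha (by omega)
    obtain ⟨z, hz, hzeq⟩ := necklaceSum_sub_mem hk0 (fun j _ => hint G j) happrox
    obtain ⟨w, hw⟩ := exists_necklaceSum_adjCoeff hG hk
    obtain ⟨u, hu, hueq⟩ := happrox (2 * k) (Finset.mem_Icc.2 ⟨by omega, le_rfl⟩)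
    have hy : approxCoeff n a (2 * k) ∈ oddDenSubring := by
      rw [hueq]
      exact add_mem (hint G _) (mul_mem (natCast_mem _ 4) hu)
    obtain ⟨r, hr⟩ := hn
    have hlast : (a (2 * k + 1) : ℚ) = 2 ^ (2 * k) * ((2 * r + 1) * approxCoeff n a (2 * k)) := by
      rw [approxCoeff, if_pos (even_two_mul k), hr]
      push_cast
      field_simp
    -- With `n = 2r + 1` and `x = approxCoeff n a (2k)`, the difference divided by `2^(2k)` is `n x
    -- - (N - x) = 2(r+1)x - N`, where `N = 2(z + w)`.
    refine ⟨(r + 1 : ℕ) * approxCoeff n a (2 * k) - (w + z),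
      sub_mem (mul_mem (natCast_mem _ _) hy) (add_mem (intCast_mem _ w) hz), ?_⟩
    have hN : necklaceSum k (approxCoeff n a) = 2 * z + 2 * w := by
      rw [← hzeq, ← hw]
      ring
    rw [hlast, hN]
    push_cast
    ring
  · intro H _ hH c hc hac
    -- Only the parity of `b_(2k)` is needed, since `a_(2k+1) ≡ -2^(2k) n b_(2k)` modulo `2^(2k+2)`.
    -- Both necklace sums are even, and their truncated parts agree modulo 2.
    have hdvd : (2 : ℤ) ∣ adjCoeff G (2 * k) - adjCoeff H (2 * k) := by
      obtain ⟨w, hw⟩ := exists_necklaceSum_adjCoeff hG hk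
      obtain ⟨v, hv⟩ := exists_necklaceSum_adjCoeff hH hk
      rw [necklaceSum_eq_add_of_one_eq_zero hk (by rw [adjCoeff_one]; simp)] at hw hv
      have hcong := necklaceSum_sub_mem hk0
        (x := fun j => if j < 2 * k - 1 then -(adjCoeff G j : ℚ) else 0)
        (y := fun j => if j < 2 * k - 1 then -(adjCoeff H j : ℚ) else 0)
        (fun j _ => by
          split_ifs
          · exact hint G j
          · exact zero_mem _)
        (fun j hj => by
          split_ifs with hjk
          · obtain ⟨t, ht⟩ := four_dvd_adjCoeff_sub hn hV hG ha hH hc hkn' hac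
              (Finset.mem_Icc.1 hj).1 hjk
            refine ⟨t, intCast_mem _ t, ?_⟩
            have ht' := congrArg (Int.cast : ℤ → ℚ) ht
            push_cast at ht'
            linarith
          · exact ⟨0, zero_mem _, by ring⟩)
      obtain ⟨z, hz, hzeq⟩ := hcong
      have hmod : RatModTwoPow 1 (adjCoeff G (2 * k) : ℚ) (adjCoeff H (2 * k) : ℚ) := by
        rw [ratModTwoPow_iff]
        refine ⟨v - w - z, sub_mem (sub_mem (intCast_mem _ v) (intCast_mem _ w)) hz, ?_⟩
        linarith
      rw [ratModTwoPow_intCast_iff, pow_one] at hmod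
      exact hmod.symm.dvd
    obtain ⟨s, hs⟩ := hdvd
    obtain ⟨z, hz⟩ := exists_coeff_odd hG k
    obtain ⟨w, hw⟩ := exists_coeff_odd hH k
    rw [ha.eq_coeff hV hkn', hc.eq_coeff hV hkn', hz, hw]
    refine (Int.modEq_iff_dvd.2 ⟨-((Fintype.card V : ℤ) * s + 2 * (z - w)), ?_⟩).symm
    linear_combination -2 ^ (2 * k) * (Fintype.card V : ℤ) * hs
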